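/- Let $M$ be a smooth manifold, $G$ a Lie group, $\pi\colon P\to M$ a smooth principal $G$-bundle with a principal connection, $V$ a finite-dimensional real $G$-module (with smooth action), and $P\times_G V=(P\times V)/G$ the associated vector bundle, where $(p,v)g=(pg,g^{-1}v)$. Manifolds are finite-dimensional, Hausdorff and without boundary. For $p\in P_x$ write $z\mapsto p\backslash z$ for the isomorphism $(P\times_G V)_x\to V$ inverse to $v\mapsto[p,v]$. For a vector field $X$ on $M$ let $X^H$ be its horizontal lift to $P$, and let $\nabla$ be the induced covariant derivative on $P\times_G V$: for a smooth section $s$, $p\backslash(\nabla_X s)(x)$ is the derivative at $p\in P_x$ of the function $q\mapsto q\backslash s(\pi(q))$ along $X^H$. For $\beta\in\Omega^k(M,P\times_G V)$, $k\ge 0$, the exterior covariant derivative is $$d^\nabla\beta(X_0,\dots,X_k)=\sum_{j=0}^k(-1)^j\nabla_{X_j}\bigl(\beta(X_0,\dots,\widehat{X_j},\dots,X_k)\bigr)+\sum_{i<j}(-1)^{i+j}\beta([X_i,X_j],X_0,\dots,\widehat{X_i},\dots,\widehat{X_j},\dots,X_k),$$ and $i_Z\beta=\beta(Z,\cdot,\dots,\cdot)$,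 with $i_Z\beta=0$ for $k=0$. Denote the flow of a vector field $X$ by $\Phi_X^t$. Regard $\beta$ as a bundle map $\Lambda^kTM\to P\times_G V$. The Darboux--Lie derivative of $\beta$ along a $G$-invariant vector field $\widetilde X$ on $P$ that projects onto the vector field $X$ on $M$ is the bundle map $\mathcal L_{\widetilde X}\beta\colon\Lambda^kTM\to P\times_G V$ with $$(\mathcal L_{\widetilde X}\beta)(y)=\Bigl[p,\ \tfrac{d}{dt}\Big|_{t=0}(\Phi_{\widetilde X}^t p)\backslash\beta\bigl(\Lambda^k(T_x\Phi_X^t)\,y\bigr)\Bigr]\qquad(y\in\Lambda^kT_xM,\ p\in P_x).$$ Then for every smooth vector field $Z$ on $M$ and every $\beta\in\Omega^k(M,P\times_G V)$: the horizontal lift $Z^H$ is a smooth $G$-invariant vector field on $P$ that projects onto $Z$; the derivative defining $\mathcal L_{Z^H}\beta$ exists, and its result is independent of $p$; $\mathcal L_{Z^H}\beta$ is again a $k$-form in $\Omega^k(M,P\times_G V)$; and $$\mathcal L_{Z^H}\beta=i_Z\,d^\nabla\beta+d^\nabla\, i_Z\beta .$$ That is, $\mathcal L_{Z^H}\beta$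 coincides with the covariant-Lie derivative $\mathcal L^\nabla_Z\beta:=i_Zd^\nabla\beta+d^\nabla i_Z\beta$; the identity means that both sides agree on all smooth vector fields $Y_1,\dots,Y_k$ on $M$. -/

import Mathlib

open scoped Manifold ContDiff

noncomputable section

namespace DarbouxLie

/-! ### Vector fields and flows -/

section Flow

/-- `𝔛(M)`: smooth vector fields on a smooth manifold `M` (without boundary) modelled on `E`. -/
abbrev SmoothVF (E : Type*) [NormedAddCommGroup E] [NormedSpace ℝ E]
    (M : Type*) [TopologicalSpace M] [ChartedSpace E M] [IsManifold 𝓘(ℝ, E) ∞ M] :=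
  ContMDiffSection 𝓘(ℝ, E) E ∞ (TangentSpace 𝓘(ℝ, E) : M → Type _)

variable {E : Type*} [NormedAddCommGroup E] [NormedSpace ℝ E]
  {M : Type*} [TopologicalSpace M] [ChartedSpace E M]

open Classical in
/-- `Φ_X^t (x)`: the value at time `t` of the integral curve of `X` starting at `x`.
If no integral curve starting at `x` is defined on an open interval containing `0` and `t`
(that is, if `(t, x)` is outside of the domain of the flow), the junk value is `x`. -/
def flow (X : ∀ x : M, TangentSpace 𝓘(ℝ, E) x) (t : ℝ) (x : M) : M :=
  if h : ∃ γ : ℝ → M, ∃ a b : ℝ, (0 : ℝ) ∈ Set.Ioo a b ∧ t ∈ Set.Ioo a b ∧ γ 0 = x ∧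
      IsMIntegralCurveOn γ X (Set.Ioo a b)
  then h.choose t else x

end Flow

/-! ### Principal bundles -/

/-- A smooth principal `G`-bundle `P → M` with its right action of `G`: every point of `M` has an
open neighbourhood `U` with a `G`-equivariant diffeomorphism `π⁻¹(U) → U × G` over `U`. -/
structure PrincipalBundle
    (F : Type*) [NormedAddCommGroup F] [NormedSpace ℝ F]
    (G : Type*) [TopologicalSpace G] [ChartedSpace F G] [Group G] [LieGroup 𝓘(ℝ, F) ∞ G]
    (E : Type*) [NormedAddCommGroup E] [NormedSpace ℝ E]
    (M : Type*) [TopologicalSpace M] [ChartedSpace E M] [IsManifold 𝓘(ℝ, E) ∞ M]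
    (B : Type*) [NormedAddCommGroup B] [NormedSpace ℝ B]
    (P : Type*) [TopologicalSpace P] [ChartedSpace B P] [IsManifold 𝓘(ℝ, B) ∞ P] where
  /-- the projection `π : P → M` -/
  proj : P → M
  /-- the right action `(p, g) ↦ p g` -/
  act : P → G → P
  act_one : ∀ p, act p 1 = p
  act_mul : ∀ p g h, act p (g * h) = act (act p g) h
  proj_act : ∀ p g, proj (act p g) = proj p
  smooth_proj : ContMDiff 𝓘(ℝ, B) 𝓘(ℝ, E) ∞ proj
  smooth_act : ContMDiff (𝓘(ℝ, B).prod 𝓘(ℝ, F)) 𝓘(ℝ, B) ∞ (fun q : P × G => act q.1 q.2)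
  locally_trivial : ∀ x : M, ∃ (U : Set M) (e : OpenPartialHomeomorph P (M × G)),
    IsOpen U ∧ x ∈ U ∧ e.source = proj ⁻¹' U ∧ e.target = U ×ˢ Set.univ ∧
    ContMDiffOn 𝓘(ℝ, B) (𝓘(ℝ, E).prod 𝓘(ℝ, F)) ∞ e e.source ∧
    ContMDiffOn (𝓘(ℝ, E).prod 𝓘(ℝ, F)) 𝓘(ℝ, B) ∞ e.symm e.target ∧
    (∀ p ∈ e.source, (e p).1 = proj p) ∧
    (∀ p ∈ e.source, ∀ g, e (act p g) = ((e p).1, (e p).2 * g))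

section Bundle

variable
  {F : Type*} [NormedAddCommGroup F] [NormedSpace ℝ F]
  {G : Type*} [TopologicalSpace G] [ChartedSpace F G] [Group G] [LieGroup 𝓘(ℝ, F) ∞ G]
  {E : Type*} [NormedAddCommGroup E] [NormedSpace ℝ E]
  {M : Type*} [TopologicalSpace M] [ChartedSpace E M] [IsManifold 𝓘(ℝ, E) ∞ M]
  {B : Type*} [NormedAddCommGroup B] [NormedSpace ℝ B]
  {P : Type*} [TopologicalSpace P] [ChartedSpace B P] [IsManifold 𝓘(ℝ, B) ∞ P]

namespace PrincipalBundle

/-- The fibre `P_x`. -/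
def Fiber (Q : PrincipalBundle F G E M B P) (x : M) : Type _ := {p : P // Q.proj p = x}

/-- A point of `P`, as a point of its fibre. -/
def self (Q : PrincipalBundle F G E M B P) (p : P) : Q.Fiber (Q.proj p) := ⟨p, rfl⟩

theorem existsUnique_act (Q : PrincipalBundle F G E M B P) (p q : P)
    (h : Q.proj p = Q.proj q) : ∃! g : G, Q.act p g = q := by
  obtain ⟨U, e, -, hx, hs, -, -, -, hfst, heq⟩ := Q.locally_trivial (Q.proj p)
  have hp : p ∈ e.source := by rw [hs]; exact hx
  have hq : q ∈ e.source := by rw [hs]; show Q.proj q ∈ U; rw [← h]; exact hx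
  have hact : ∀ g, Q.act p g ∈ e.source := fun g => by
    rw [hs]; show Q.proj (Q.act p g) ∈ U; rw [Q.proj_act]; exact hx
  refine ⟨(e p).2⁻¹ * (e q).2, ?_, ?_⟩
  · apply e.injOn (hact _) hq
    rw [heq p hp]
    ext
    · simp only [hfst p hp, hfst q hq, h]
    · simp
  · intro g hg
    have h1 := heq p hp g
    rw [hg] at h1
    rw [h1]; simp

theorem fiber_nonempty (Q : PrincipalBundle F G E M B P) (x : M) : Nonempty (Q.Fiber x) := by
  obtain ⟨U, e, -, hx, -, ht, -, -, hfst, -⟩ := Q.locally_trivial x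
  have hmem : ((x, 1) : M × G) ∈ e.target := by rw [ht]; exact ⟨hx, Set.mem_univ _⟩
  refine ⟨⟨e.symm (x, 1), ?_⟩⟩
  rw [← hfst _ (e.map_target hmem), e.right_inv hmem]

/-- Some point of the fibre `P_x`. -/
def point (Q : PrincipalBundle F G E M B P) (x : M) : Q.Fiber x :=
  Classical.choice (Q.fiber_nonempty x)

/-- `p \ q`, the unique `g ∈ G` such that `p g = q`, for `p` and `q` in the same fibre. -/
def div (Q : PrincipalBundle F G E M B P) {x : M} (p q : Q.Fiber x) : G :=
  (Q.existsUnique_act p.1 q.1 (p.2.trans q.2.symm)).choose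

theorem act_div (Q : PrincipalBundle F G E M B P) {x : M} (p q : Q.Fiber x) :
    Q.act p.1 (Q.div p q) = q.1 :=
  (Q.existsUnique_act p.1 q.1 (p.2.trans q.2.symm)).choose_spec.1

theorem div_eq (Q : PrincipalBundle F G E M B P) {x : M} (p q : Q.Fiber x) {g : G}
    (h : Q.act p.1 g = q.1) : Q.div p q = g :=
  (Q.existsUnique_act p.1 q.1 (p.2.trans q.2.symm)).unique (Q.act_div p q) h

theorem div_self (Q : PrincipalBundle F G E M B P) {x : M} (p : Q.Fiber x) : Q.div p p = 1 :=
  Q.div_eq p p (Q.act_one _)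

theorem div_mul_div (Q : PrincipalBundle F G E M B P) {x : M} (p q r : Q.Fiber x) :
    Q.div p q * Q.div q r = Q.div p r :=
  (Q.div_eq p r (by rw [Q.act_mul, Q.act_div, Q.act_div])).symm

/-- The vector field on `M` onto which a `G`-invariant vector field on `P` projects. -/
def base (Q : PrincipalBundle F G E M B P) (X : ∀ p : P, TangentSpace 𝓘(ℝ, B) p) (x : M) :
    TangentSpace 𝓘(ℝ, E) x :=
  (Q.point x).2 ▸ mfderiv 𝓘(ℝ, B) 𝓘(ℝ, E) Q.proj (Q.point x).1 (X (Q.point x).1)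

end PrincipalBundle

/-! ### The associated vector bundle `P ×_G V` of a `G`-module `V` -/

variable {V : Type*} [NormedAddCommGroup V] [NormedSpace ℝ V]

/-- The orbits in `P_x × V` of the action `(p, v) g = (p g, g⁻¹ v)`. -/
def assocSetoid (Q : PrincipalBundle F G E M B P) (ρ : Representation ℝ G V) (x : M) :
    Setoid (Q.Fiber x × V) where
  r a b := ∃ g : G, b.1.1 = Q.act a.1.1 g ∧ b.2 = ρ g⁻¹ a.2
  iseqv :=
    { refl := fun a => ⟨1, by simp [Q.act_one], by simp⟩
      symm := by
        rintro a b ⟨g, h1, h2⟩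
        refine ⟨g⁻¹, ?_, ?_⟩
        · rw [h1, ← Q.act_mul, mul_inv_cancel, Q.act_one]
        · rw [h2, inv_inv, ← Module.End.mul_apply, ← map_mul, mul_inv_cancel, map_one]; rfl
      trans := by
        rintro a b c ⟨g, h1, h2⟩ ⟨g', h1', h2'⟩
        refine ⟨g * g', ?_, ?_⟩
        · rw [h1', h1, Q.act_mul]
        · rw [h2', h2, ← Module.End.mul_apply, ← map_mul, mul_inv_rev] }

/-- The fibre over `x` of the associated bundle `P ×_G V = (P × V) / G`. -/
def Assoc (Q : PrincipalBundle F G E M B P) (ρ : Representation ℝ G V) (x : M) : Type _ :=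
  Quotient (assocSetoid Q ρ x)

namespace Assoc

variable {Q : PrincipalBundle F G E M B P} {ρ : Representation ℝ G V} {x : M}

/-- The class `[p, v]`. -/
def mk (p : Q.Fiber x) (v : V) : Assoc Q ρ x := Quotient.mk (assocSetoid Q ρ x) (p, v)

/-- `p \ [p', v] = (p \ p') v`. -/
def coord (p : Q.Fiber x) (z : Assoc Q ρ x) : V :=
  Quotient.lift (s := assocSetoid Q ρ x) (fun a => ρ (Q.div p a.1) a.2) (by
    rintro ⟨q, v⟩ ⟨q', v'⟩ ⟨g, h1, h2⟩
    have h3 : Q.div q q' = g := Q.div_eq q q' h1.symm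
    simp only at h2 ⊢
    rw [← Q.div_mul_div p q q', h3, h2, map_mul, Module.End.mul_apply,
      ← Module.End.mul_apply (ρ g), ← map_mul, mul_inv_cancel, map_one]
    rfl) z

theorem coord_mk (p q : Q.Fiber x) (v : V) :
    coord p (mk q v : Assoc Q ρ x) = ρ (Q.div p q) v := rfl

theorem mk_coord (p : Q.Fiber x) (z : Assoc Q ρ x) : mk p (coord p z) = z := by
  obtain ⟨⟨q, v⟩, rfl⟩ := Quotient.exists_rep z
  refine Quotient.sound (s := assocSetoid Q ρ x) ⟨Q.div p q, (Q.act_div p q).symm, ?_⟩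
  change v = ρ (Q.div p q)⁻¹ (ρ (Q.div p q) v)
  rw [← Module.End.mul_apply, ← map_mul, inv_mul_cancel, map_one]
  rfl

theorem coord_eq (p q : Q.Fiber x) (z : Assoc Q ρ x) :
    coord p z = ρ (Q.div p q) (coord q z) := by
  conv_lhs => rw [← mk_coord q z]
  exact coord_mk p q _

/-- The bijection `z ↦ p \ z` from the fibre over `x` to `V`, for `p ∈ P_x`. -/
def coordEquiv (p : Q.Fiber x) : Assoc Q ρ x ≃ V where
  toFun := coord p
  invFun := mk p
  left_inv := mk_coord p
  right_inv v := by rw [coord_mk, Q.div_self, map_one]; rfl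

instance : AddCommGroup (Assoc Q ρ x) := (coordEquiv (Q.point x)).addCommGroup

instance : Module ℝ (Assoc Q ρ x) := (coordEquiv (Q.point x)).module ℝ

/-- The vector space structure of the fibre is the one for which `z ↦ p \ z` is linear,
for every `p ∈ P_x`. -/
theorem coord_add (p : Q.Fiber x) (z w : Assoc Q ρ x) :
    coord p (z + w) = coord p z + coord p w := by
  have h : coord (Q.point x) (z + w) = coord (Q.point x) z + coord (Q.point x) w :=
    (coordEquiv (Q.point x)).apply_symm_apply _
  rw [coord_eq p (Q.point x) (z + w), h, map_add, ← coord_eq, ← coord_eq]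

theorem coord_smul (p : Q.Fiber x) (c : ℝ) (z : Assoc Q ρ x) :
    coord p (c • z) = c • coord p z := by
  have h : coord (Q.point x) (c • z) = c • coord (Q.point x) z :=
    (coordEquiv (Q.point x)).apply_symm_apply _
  rw [coord_eq p (Q.point x) (c • z), h, map_smul, ← coord_eq]

end Assoc

open Classical in
/-- `q \ z` for `q ∈ P` and `z` in the total space of `P ×_G V`; it is only meaningful, and
otherwise set to `0`, if `q` and `z` lie over the same point of `M`. -/
def totalCoord {Q : PrincipalBundle F G E M B P} {ρ : Representation ℝ G V}
    (q : P) (z : Σ x : M, Assoc Q ρ x) : V :=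
  if h : Q.proj q = z.1 then Assoc.coord (⟨q, h⟩ : Q.Fiber z.1) z.2 else 0

/-- The `G`-equivariant function `p ↦ p \ s(π(p))` on `P` of a section `s` of `P ×_G V`. -/
def sectionFun {Q : PrincipalBundle F G E M B P} {ρ : Representation ℝ G V}
    (s : ∀ x : M, Assoc Q ρ x) (p : P) : V :=
  Assoc.coord (Q.self p) (s (Q.proj p))

/-- Smoothness of a section of `P ×_G V`: in the local trivialisation `[σ(x), v] ↦ (x, v)` given by
a local section `σ` of `P`, the section `s` is `x ↦ σ(x) \ s(x)`; all of these are smooth if and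
only if `p ↦ p \ s(π(p))` is. -/
def IsSmoothSection {Q : PrincipalBundle F G E M B P} {ρ : Representation ℝ G V}
    (s : ∀ x : M, Assoc Q ρ x) : Prop :=
  ContMDiff 𝓘(ℝ, B) 𝓘(ℝ, V) ∞ (sectionFun s)

/-! ### Differential forms with values in `P ×_G V` -/

/-- `Ω^k(M, P ×_G V)`: families of alternating `k`-linear maps `(T_x M)^k → (P ×_G V)_x` that take
smooth vector fields to smooth sections. -/
structure AssocForm (Q : PrincipalBundle F G E M B P) (ρ : Representation ℝ G V) (k : ℕ) where
  /-- the value at a point -/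
  toFun : ∀ x : M, (TangentSpace 𝓘(ℝ, E) x) [⋀^Fin k]→ₗ[ℝ] Assoc Q ρ x
  smooth : ∀ Y : Fin k → SmoothVF E M, IsSmoothSection (fun x => toFun x (fun i => Y i x))

namespace AssocForm

variable {Q : PrincipalBundle F G E M B P} {ρ : Representation ℝ G V} {k : ℕ}

/-- A `k`-form as a fibrewise linear bundle map `Λ^k TM → P ×_G V`. -/
def bundleMap (β : AssocForm Q ρ k) (x : M) :
    ⋀[ℝ]^k (TangentSpace 𝓘(ℝ, E) x) →ₗ[ℝ] Assoc Q ρ x :=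
  exteriorPower.alternatingMapLinearEquiv (β.toFun x)

/-- The contraction `i_Z β`. -/
def interior (Z : SmoothVF E M) (β : AssocForm Q ρ (k + 1)) : AssocForm Q ρ k where
  toFun x := (β.toFun x).curryLeft (Z x)
  smooth Y := by
    have h := β.smooth (Matrix.vecCons Z Y)
    convert h using 3 with x
    rw [AlternatingMap.curryLeft_apply_apply]
    congr 1
    funext i
    refine Fin.cases ?_ (fun j => ?_) i <;> rfl

end AssocForm

/-! ### Principal connections, covariant derivative and exterior covariant derivative -/

/-- A principal connection on `P`, given by its horizontal lifts: a smooth `G`-equivariant right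
inverse of `Tπ : TP → π^* TM`. Its image is the horizontal distribution. -/
structure PrincipalConnection (Q : PrincipalBundle F G E M B P) where
  /-- the horizontal lift to `T_p P` of a vector tangent to `M` at `π(p)` -/
  lift : ∀ p : P, TangentSpace 𝓘(ℝ, E) (Q.proj p) →ₗ[ℝ] TangentSpace 𝓘(ℝ, B) p
  proj_lift : ∀ p v, mfderiv 𝓘(ℝ, B) 𝓘(ℝ, E) Q.proj p (lift p v) = v
  equivariant : ∀ (X : ∀ x : M, TangentSpace 𝓘(ℝ, E) x) (p : P) (g : G),
    lift (Q.act p g) (X (Q.proj (Q.act p g))) =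
      mfderiv 𝓘(ℝ, B) 𝓘(ℝ, B) (fun q => Q.act q g) p (lift p (X (Q.proj p)))
  smooth : ∀ X : SmoothVF E M, ContMDiff 𝓘(ℝ, B) 𝓘(ℝ, B).tangent ∞
    (fun p => (⟨p, lift p (X (Q.proj p))⟩ : TangentBundle 𝓘(ℝ, B) P))

namespace PrincipalConnection

variable {Q : PrincipalBundle F G E M B P} (A : PrincipalConnection Q)

/-- The horizontal lift `X^H` of a vector field `X` on `M`. -/
def horizontalLift (X : ∀ x : M, TangentSpace 𝓘(ℝ, E) x) (p : P) : TangentSpace 𝓘(ℝ, B) p :=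
  A.lift p (X (Q.proj p))

variable {ρ : Representation ℝ G V}

/-- The induced covariant derivative on `P ×_G V`: `p \ (∇_X s)(x)` is, for `p ∈ P_x`, the
derivative of the function `q ↦ q \ s(π(q))` along the horizontal lift of `X` at `p`. -/
def nabla (X : ∀ x : M, TangentSpace 𝓘(ℝ, E) x) (s : ∀ x : M, Assoc Q ρ x) (x : M) :
    Assoc Q ρ x :=
  Assoc.mk (Q.point x)
    (mfderiv 𝓘(ℝ, B) 𝓘(ℝ, V) (sectionFun s) (Q.point x).1
      (A.horizontalLift X (Q.point x).1))

/-- The part `∑_j (-1)^j ∇_{X_j} (β(X_0, …, X̂_j, …, X_k))` of the exterior covariant derivative. -/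
def dNablaFirst {k : ℕ} (β : AssocForm Q ρ k)
    (X : Fin (k + 1) → ∀ x : M, TangentSpace 𝓘(ℝ, E) x) (x : M) : Assoc Q ρ x :=
  ∑ j : Fin (k + 1), (-1 : ℝ) ^ (j : ℕ) •
    A.nabla (X j) (fun y => β.toFun y (fun i => j.removeNth X i y)) x

/-- The exterior covariant derivative
`d^∇ β (X_0, …, X_k) = ∑_j (-1)^j ∇_{X_j} (β(X_0, …, X̂_j, …, X_k))
  + ∑_{a < b} (-1)^{a + b} β([X_a, X_b], X_0, …, X̂_a, …, X̂_b, …, X_k)`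
as a section of `P ×_G V`. The second sum is empty for `k = 0`. For `k > 0` its terms are indexed by
`i ≤ j` in `Fin k`, where `a = i` and `b = j + 1`, which accounts for the minus sign. -/
def dNabla : {k : ℕ} → AssocForm Q ρ k →
    (Fin (k + 1) → ∀ x : M, TangentSpace 𝓘(ℝ, E) x) → ∀ x : M, Assoc Q ρ x
  | 0, β, X, x => A.dNablaFirst β X x
  | m + 1, β, X, x => A.dNablaFirst β X x -
      ∑ i : Fin (m + 1), ∑ j ∈ Finset.Ici i, (-1 : ℝ) ^ ((i : ℕ) + (j : ℕ)) •
        β.toFun x (Matrix.vecCons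
          (VectorField.mlieBracket 𝓘(ℝ, E) (X (Fin.castSucc i)) (X (Fin.succ j)) x)
          (fun l => j.removeNth ((Fin.castSucc i).removeNth X) l x))

/-- The covariant-Lie derivative `i_Z d^∇ β + d^∇ i_Z β`, evaluated on vector fields
`Y_1, …, Y_k`. For `k = 0` the form `i_Z β` is zero. -/
def covLie (Z : SmoothVF E M) : {k : ℕ} → AssocForm Q ρ k →
    (Fin k → ∀ x : M, TangentSpace 𝓘(ℝ, E) x) → ∀ x : M, Assoc Q ρ x
  | 0, β, Y, x => A.dNabla β (Matrix.vecCons Z Y) x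
  | _ + 1, β, Y, x => A.dNabla β (Matrix.vecCons Z Y) x + A.dNabla (β.interior Z) Y x

end PrincipalConnection

/-! ### The Darboux–Lie derivative -/

section Derivative

variable {Q : PrincipalBundle F G E M B P} {ρ : Representation ℝ G V} {k : ℕ}

/-- The flow on `Λ^k TM` of the canonical lift of a vector field `X` on `M`:
it maps `w ∈ Λ^k T_x M` to `Λ^k (T_x Φ_X^t) w`. -/
def liftedFlow (X : ∀ x : M, TangentSpace 𝓘(ℝ, E) x) (k : ℕ) (t : ℝ)
    (y : Σ x : M, ⋀[ℝ]^k (TangentSpace 𝓘(ℝ, E) x)) : Σ x : M, ⋀[ℝ]^k (TangentSpace 𝓘(ℝ, E) x) :=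
  ⟨flow X t y.1,
    exteriorPower.map k (mfderiv 𝓘(ℝ, E) 𝓘(ℝ, E) (flow X t) y.1).toLinearMap y.2⟩

/-- The curve `t ↦ (Φ_X^t p) \ h(Φ^t y)` in `V`, where `X` is a `G`-invariant vector field on `P`
and `Φ^t` is the flow on `Λ^k TM` of the canonical lift of the projection of `X` to `M`. -/
def darbouxLieCurve (X : ∀ p : P, TangentSpace 𝓘(ℝ, B) p)
    (h : ∀ x : M, ⋀[ℝ]^k (TangentSpace 𝓘(ℝ, E) x) → Assoc Q ρ x) (p : P)
    (y : Σ x : M, ⋀[ℝ]^k (TangentSpace 𝓘(ℝ, E) x)) (t : ℝ) : V :=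
  totalCoord (Q := Q) (ρ := ρ) (flow X t p)
    (Sigma.map id h (liftedFlow (Q.base X) k t y))

/-- The Darboux–Lie derivative along a `G`-invariant vector field `X` on `P` of a bundle map
`h : Λ^k TM → P ×_G V`. Let `X_V` be the vector field on `P ×_G V` with the flow
`[q, v] ↦ [Φ_X^t q, v]`. At `y ∈ Λ^k T_x M` the vertical vector `Th(F(X)_y) - (X_V)_{h(y)}` is the
velocity at `t = 0` of the curve `t ↦ Φ_{X_V}^{-t}(h(Φ^t y)) = [p, (Φ_X^t p) \ h(Φ^t y)]` in the
vector space `(P ×_G V)_x`, for any `p ∈ P_x`; here `F(X)` is the canonical lift with flow `Φ^t`.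
(For the chosen `p`: `h(Φ^t y) = [Φ_X^t p, v(t)]` with `v` the curve `darbouxLieCurve`, while
`X_V` at `h(y)` is the velocity of `[Φ_X^t p, v(0)]`, so that the difference is `[p, v'(0)]`.) -/
def darbouxLie (X : ∀ p : P, TangentSpace 𝓘(ℝ, B) p)
    (h : ∀ x : M, ⋀[ℝ]^k (TangentSpace 𝓘(ℝ, E) x) → Assoc Q ρ x) (x : M)
    (w : ⋀[ℝ]^k (TangentSpace 𝓘(ℝ, E) x)) : Assoc Q ρ x :=
  Assoc.mk (Q.point x) (deriv (darbouxLieCurve X h (Q.point x).1 ⟨x, w⟩) 0)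

end Derivative

end Bundle

end DarbouxLie

end

/-!
Fix a point `p` over `x` and, near `x`, the frame of constant vector fields of a chart. In this
frame the curve that defines the Darboux–Lie derivative of `β` on `Y₁ ∧ ⋯ ∧ Y_k`, and the
equivariant function of the section `β(Y₁, …, Y_k)`, both evaluated along the flow of `Z^H` through
`p`, become one curve of multilinear maps, applied to the transported vectors `TΦ_Z^t (Y_i x)` and
to the restrictions `Y_i (Φ_Z^t x)`, respectively. By the variational equation the transported
vectors have velocities `DZ · Y_i`, while the restrictions have velocities `DY_i · Z`, so that the
derivatives of the two curves differ by the terms with `[Z, Y_i] = DY_i · Z - DZ · Y_i`. Hence the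
Darboux–Lie derivative is `∇_Z (β(Y₁, …, Y_k)) - ∑ β(Y₁, …, [Z, Y_i], …, Y_k)`, which is
`i_Z d^∇ β + d^∇ i_Z β` evaluated on the `Y_i`: the other terms of that sum cancel in pairs.
-/

noncomputable section

namespace DarbouxLie

/-! ### Differentiability of a local flow in the initial value -/

section VariationalEquation

open Filter Set Metric Topology

variable {E : Type*} [NormedAddCommGroup E] [NormedSpace ℝ E]

theorem norm_le_gronwallBound_of_norm_deriv_le {e e' : ℝ → E} {r K c : ℝ}
    (he : ∀ t ∈ Ico 0 r, HasDerivAt e (e' t) t) (h0 : e 0 = 0)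
    (hb : ∀ t ∈ Ico 0 r, ‖e' t‖ ≤ K * ‖e t‖ + c) :
    ∀ t ∈ Ico 0 r, ‖e t‖ ≤ gronwallBound 0 K c t := by
  intro t ht
  have hsub {s : ℝ} (hs : s ∈ Icc 0 t) : s ∈ Ico 0 r := ⟨hs.1, hs.2.trans_lt ht.2⟩
  simpa only [sub_zero] using norm_le_gronwallBound_of_norm_deriv_right_le
    (fun s hs => (he s (hsub hs)).continuousAt.continuousWithinAt)
    (fun s hs => (he s (hsub (Ico_subset_Icc_self hs))).hasDerivWithinAt)
    (by simp [h0]) (fun s hs => hb s (hsub (Ico_subset_Icc_self hs))) t ⟨ht.1, le_rfl⟩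

theorem norm_le_gronwallBound_abs {e e' : ℝ → E} {r K c : ℝ}
    (he : ∀ t ∈ Ioo (-r) r, HasDerivAt e (e' t) t) (h0 : e 0 = 0)
    (hb : ∀ t ∈ Ioo (-r) r, ‖e' t‖ ≤ K * ‖e t‖ + c) :
    ∀ t ∈ Ioo (-r) r, ‖e t‖ ≤ gronwallBound 0 K c |t| := by
  intro t ht
  have hpos {s : ℝ} (hs : s ∈ Ico 0 r) : s ∈ Ioo (-r) r :=
    ⟨by linarith [hs.1, hs.2], hs.2⟩
  have hneg {s : ℝ} (hs : s ∈ Ico 0 r) : -s ∈ Ioo (-r) r :=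
    ⟨by linarith [hs.2], by linarith [hs.1, hs.2]⟩
  rcases le_total 0 t with h | h
  · rw [abs_of_nonneg h]
    exact norm_le_gronwallBound_of_norm_deriv_le (fun s hs => he s (hpos hs)) h0
      (fun s hs => hb s (hpos hs)) t ⟨h, ht.2⟩
  · rw [abs_of_nonpos h]
    have hreflect : ∀ s ∈ Ico 0 r, HasDerivAt (fun s => e (-s)) (-e' (-s)) s := fun s hs => by
      simpa [Function.comp_def] using (he (-s) (hneg hs)).scomp s (hasDerivAt_neg s)
    simpa using norm_le_gronwallBound_of_norm_deriv_le hreflect (by simpa using h0)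
      (fun s hs => by simpa using hb (-s) (hneg hs)) (-t) ⟨by linarith, by linarith [ht.1]⟩

theorem norm_sub_sub_fderiv_le {F : Type*} [NormedAddCommGroup F] [NormedSpace ℝ F]
    {f : E → F} {s : Set E} {K : NNReal} (hs : Convex ℝ s)
    (hf : ∀ y ∈ s, DifferentiableAt ℝ f y) (hK : LipschitzOnWith K (fderiv ℝ f) s)
    {y z : E} (hy : y ∈ s) (hz : z ∈ s) :
    ‖f y - f z - fderiv ℝ f z (y - z)‖ ≤ K * ‖y - z‖ ^ 2 := by
  have hseg : segment ℝ z y ⊆ s := hs.segment_subset hz hy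
  rw [pow_two, ← mul_assoc]
  refine (convex_segment z y).norm_image_sub_le_of_norm_fderiv_le' (𝕜 := ℝ)
    (fun w hw => hf w (hseg hw)) (fun w hw => ?_) (left_mem_segment ℝ z y)
    (right_mem_segment ℝ z y)
  calc ‖fderiv ℝ f w - fderiv ℝ f z‖ ≤ K * ‖w - z‖ := hK.norm_sub_le (hseg hw) hz
    _ ≤ K * ‖y - z‖ := by gcongr; exact norm_sub_le_of_mem_segment hw

/-- A local flow `α` of the vector field `f` on the ball of radius `δ` about `x₀`, for times
`|t| < δ`, together with the solution `J` of the first variational equation along the integral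
curve `α x₀`: `J t` is the candidate for the derivative of `y ↦ α y t` at `x₀`. The initial value
comes first in `α y t`. -/
structure IsVariationalFlow (f : E → E) (x₀ : E) (δ : ℝ) (α : E → ℝ → E) (J : ℝ → E →L[ℝ] E) :
    Prop where
  flow_zero : ∀ y ∈ ball x₀ δ, α y 0 = y
  hasDerivAt_flow : ∀ y ∈ ball x₀ δ, ∀ t ∈ Ioo (-δ) δ, HasDerivAt (α y) (f (α y t)) t
  variation_zero : J 0 = ContinuousLinearMap.id ℝ E
  hasDerivAt_variation :
    ∀ t ∈ Ioo (-δ) δ, HasDerivAt J ((fderiv ℝ f (α x₀ t)).comp (J t)) t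
  exists_norm_sub_le :
    ∃ L : NNReal, ∀ y ∈ ball x₀ δ, ∀ t ∈ Ioo (-δ) δ, ‖α y t - α x₀ t‖ ≤ L * ‖y - x₀‖

theorem exists_isVariationalFlow [CompleteSpace E] {f : E → E} {x₀ : E}
    (hf : ContDiffAt ℝ 2 f x₀) : ∃ δ > 0, ∃ α J, IsVariationalFlow f x₀ δ α J := by
  let I := ContinuousLinearMap.id ℝ E
  let S : E × (E →L[ℝ] E) → E × (E →L[ℝ] E) := fun q => (f q.1, (fderiv ℝ f q.1).comp q.2)
  have hf' : ContDiffAt ℝ 1 (fderiv ℝ f) x₀ := hf.fderiv_right (by norm_num)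
  have hS : ContDiffAt ℝ 1 S (x₀, I) :=
    ((hf.of_le (by norm_num)).comp (x₀, I) contDiffAt_fst).prodMk
      ((hf'.comp (x₀, I) contDiffAt_fst).clm_comp contDiffAt_snd)
  obtain ⟨ε, hε, a, r, _, _, hr, hpl⟩ := IsPicardLindelof.of_contDiffAt_one hS
  obtain ⟨Ψ, hΨ, L, hL⟩ :=
    (hpl 0).exists_forall_mem_closedBall_eq_hasDerivWithinAt_lipschitzOnWith
  simp only [zero_sub, zero_add] at hΨ hL
  have hr' : (0 : ℝ) < r := hr
  let δ := min (r : ℝ) ε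
  have hδ : 0 < δ := lt_min hr' hε
  have htime {t : ℝ} (ht : t ∈ Ioo (-δ) δ) : t ∈ Ioo (-ε) ε :=
    ⟨by linarith [ht.1, min_le_right (r : ℝ) ε], ht.2.trans_le (min_le_right _ _)⟩
  have hmem {y : E} (hy : y ∈ ball x₀ δ) : (y, I) ∈ closedBall (x₀, I) (r : ℝ) := by
    rw [mem_closedBall, Prod.dist_eq, dist_self]
    exact max_le ((mem_ball.1 hy).le.trans (min_le_left _ _)) hr'.le
  have hx₀ : x₀ ∈ ball x₀ δ := mem_ball_self hδ
  have hder : ∀ y ∈ ball x₀ δ, ∀ t ∈ Ioo (-δ) δ, HasDerivAt (Ψ (y, I)) (S (Ψ (y, I) t)) t :=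
    fun y hy t ht => ((hΨ _ (hmem hy)).2 t (Ioo_subset_Icc_self (htime ht))).hasDerivAt
      (Icc_mem_nhds (htime ht).1 (htime ht).2)
  refine ⟨δ, hδ, fun y t => (Ψ (y, I) t).1, fun t => (Ψ (x₀, I) t).2, ?_⟩
  refine ⟨fun y hy => ?_, fun y hy t ht => (hder y hy t ht).fst, ?_,
    fun t ht => (hder x₀ hx₀ t ht).snd, L, fun y hy t ht => ?_⟩
  · simp only [(hΨ _ (hmem hy)).1]
  · simp only [(hΨ _ (hmem hx₀)).1, I]
  · have h := (hL t (Ioo_subset_Icc_self (htime ht))).dist_le_mul _ (hmem hy) _ (hmem hx₀)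
    rw [Prod.dist_eq, Prod.dist_eq (x := (y, _)), dist_self, max_eq_left dist_nonneg] at h
    simpa only [← dist_eq_norm] using (le_max_left _ _).trans h

namespace IsVariationalFlow

variable {f : E → E} {x₀ : E} {δ : ℝ} {α : E → ℝ → E} {J : ℝ → E →L[ℝ] E}

theorem mono (h : IsVariationalFlow f x₀ δ α J) {η : ℝ} (hη : η ≤ δ) :
    IsVariationalFlow f x₀ η α J := by
  have hball : ball x₀ η ⊆ ball x₀ δ := ball_subset_ball hη
  have htime : Ioo (-η) η ⊆ Ioo (-δ) δ := Ioo_subset_Ioo (neg_le_neg hη) hη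
  obtain ⟨L, hL⟩ := h.exists_norm_sub_le
  exact ⟨fun y hy => h.flow_zero y (hball hy),
    fun y hy t ht => h.hasDerivAt_flow y (hball hy) t (htime ht), h.variation_zero,
    fun t ht => h.hasDerivAt_variation t (htime ht), L,
    fun y hy t ht => hL y (hball hy) t (htime ht)⟩

theorem hasDerivAt_variation_zero (h : IsVariationalFlow f x₀ δ α J) (hδ : 0 < δ) :
    HasDerivAt J (fderiv ℝ f x₀) 0 := by
  have hJ := h.hasDerivAt_variation 0 ⟨neg_lt_zero.2 hδ, hδ⟩
  rwa [h.flow_zero x₀ (mem_ball_self hδ), h.variation_zero, ContinuousLinearMap.comp_id] at hJ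

theorem continuousAt_flow (h : IsVariationalFlow f x₀ δ α J) (hδ : 0 < δ) :
    ContinuousAt (fun q : E × ℝ => α q.1 q.2) (x₀, 0) := by
  have hx₀ : x₀ ∈ ball x₀ δ := mem_ball_self hδ
  have h0 : (0 : ℝ) ∈ Ioo (-δ) δ := ⟨neg_lt_zero.2 hδ, hδ⟩
  have hcurve : Tendsto (fun q : E × ℝ => α x₀ q.2) (𝓝 (x₀, 0)) (𝓝 (α x₀ 0)) :=
    (h.hasDerivAt_flow x₀ hx₀ 0 h0).continuousAt.tendsto.comp continuousAt_snd
  obtain ⟨L, hL⟩ := h.exists_norm_sub_le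
  refine hcurve.congr_dist (squeeze_zero' (g := fun q : E × ℝ => L * ‖q.1 - x₀‖)
    (.of_forall fun _ => dist_nonneg) ?_ ?_)
  · filter_upwards [prod_mem_nhds (ball_mem_nhds x₀ hδ) (Ioo_mem_nhds h0.1 h0.2)] with q hq
    rw [dist_comm, dist_eq_norm]
    exact hL q.1 hq.1 q.2 hq.2
  · have : Continuous fun q : E × ℝ => (L : ℝ) * ‖q.1 - x₀‖ := by fun_prop
    simpa using this.tendsto (x₀, 0)

theorem exists_forall_mem (h : IsVariationalFlow f x₀ δ α J) (hδ : 0 < δ) {U : Set E}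
    (hU : U ∈ 𝓝 x₀) : ∃ η > 0, η ≤ δ ∧ ∀ y ∈ ball x₀ η, ∀ t ∈ Ioo (-η) η, α y t ∈ U := by
  have hU' : U ∈ 𝓝 (α x₀ 0) := by rwa [h.flow_zero x₀ (mem_ball_self hδ)]
  obtain ⟨η, hη, hsub⟩ := Metric.mem_nhds_iff.1 (h.continuousAt_flow hδ hU')
  refine ⟨min η δ, lt_min hη hδ, min_le_right _ _, fun y hy t ht => ?_⟩
  have hyt : (y, t) ∈ ball ((x₀, 0) : E × ℝ) η := by
    rw [← ball_prod_same, Real.ball_eq_Ioo, zero_sub, zero_add]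
    exact ⟨ball_subset_ball (min_le_left _ _) hy,
      Ioo_subset_Ioo (neg_le_neg (min_le_left _ _)) (min_le_left _ _) ht⟩
  exact hsub hyt

/-- The error `α y t - α x₀ t - J t (y - x₀)` vanishes at `t = 0` and satisfies the linear
variational equation up to the quadratic Taylor remainder of `f`, so Grönwall applies to it. -/
theorem exists_norm_sub_sub_variation_le (h : IsVariationalFlow f x₀ δ α J) (hδ : 0 < δ)
    {U : Set E} {K : NNReal} {C : ℝ} (hU : Convex ℝ U) (hf : ∀ y ∈ U, DifferentiableAt ℝ f y)
    (hK : LipschitzOnWith K (fderiv ℝ f) U) (hC : ∀ y ∈ U, ‖fderiv ℝ f y‖ ≤ C)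
    (hα : ∀ y ∈ ball x₀ δ, ∀ t ∈ Ioo (-δ) δ, α y t ∈ U) {t : ℝ} (ht : t ∈ Ioo (-δ) δ) :
    ∃ c : ℝ, ∀ y ∈ ball x₀ δ, ‖α y t - α x₀ t - J t (y - x₀)‖ ≤ c * ‖y - x₀‖ ^ 2 := by
  have hx₀ : x₀ ∈ ball x₀ δ := mem_ball_self hδ
  obtain ⟨L, hL⟩ := h.exists_norm_sub_le
  refine ⟨K * L ^ 2 * gronwallBound 0 C 1 |t|, fun y hy => ?_⟩
  let e : ℝ → E := fun s => α y s - α x₀ s - J s (y - x₀)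
  let e' : ℝ → E := fun s => f (α y s) - f (α x₀ s) - fderiv ℝ f (α x₀ s) (J s (y - x₀))
  have he : ∀ s ∈ Ioo (-δ) δ, HasDerivAt e (e' s) s := fun s hs =>
    ((h.hasDerivAt_flow y hy s hs).sub (h.hasDerivAt_flow x₀ hx₀ s hs)).sub
      (by simpa using (h.hasDerivAt_variation s hs).clm_apply (hasDerivAt_const s (y - x₀)))
  have he0 : e 0 = 0 := by simp [e, h.flow_zero y hy, h.flow_zero x₀ hx₀, h.variation_zero]
  have hbound : ∀ s ∈ Ioo (-δ) δ, ‖e' s‖ ≤ C * ‖e s‖ + K * (L * ‖y - x₀‖) ^ 2 := by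
    intro s hs
    have htaylor := norm_sub_sub_fderiv_le hU hf hK (hα y hy s hs) (hα x₀ hx₀ s hs)
    have hsplit : e' s = fderiv ℝ f (α x₀ s) (e s) +
        (f (α y s) - f (α x₀ s) - fderiv ℝ f (α x₀ s) (α y s - α x₀ s)) := by
      simp only [e, e', map_sub]; abel
    calc ‖e' s‖ ≤ ‖fderiv ℝ f (α x₀ s)‖ * ‖e s‖ + K * ‖α y s - α x₀ s‖ ^ 2 := by
          rw [hsplit]
          exact (norm_add_le _ _).trans
            (add_le_add (ContinuousLinearMap.le_opNorm _ _) htaylor)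
      _ ≤ C * ‖e s‖ + K * (L * ‖y - x₀‖) ^ 2 := by
          gcongr
          exacts [hC _ (hα x₀ hx₀ s hs), hL y hy s hs]
  refine (norm_le_gronwallBound_abs he he0 hbound t ht).trans_eq ?_
  simp only [gronwallBound]
  split_ifs <;> ring

theorem hasFDerivAt_flow (h : IsVariationalFlow f x₀ δ α J) (hδ : 0 < δ)
    {U : Set E} {K : NNReal} {C : ℝ} (hU : Convex ℝ U) (hf : ∀ y ∈ U, DifferentiableAt ℝ f y)
    (hK : LipschitzOnWith K (fderiv ℝ f) U) (hC : ∀ y ∈ U, ‖fderiv ℝ f y‖ ≤ C)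
    (hα : ∀ y ∈ ball x₀ δ, ∀ t ∈ Ioo (-δ) δ, α y t ∈ U) {t : ℝ} (ht : t ∈ Ioo (-δ) δ) :
    HasFDerivAt (fun y => α y t) (J t) x₀ := by
  obtain ⟨c, hc⟩ := h.exists_norm_sub_sub_variation_le hδ hU hf hK hC hα ht
  have hquad : (fun y => α y t - α x₀ t - J t (y - x₀)) =O[𝓝 x₀] fun y => ‖y - x₀‖ ^ 2 :=
    .of_bound c <| by
      filter_upwards [ball_mem_nhds x₀ hδ] with y hy
      simpa using hc y hy
  have hsmall : (fun y => ‖y - x₀‖ ^ 2) =o[𝓝 x₀] fun y => y - x₀ :=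
    (Asymptotics.isLittleO_norm_pow_id one_lt_two).comp_tendsto
      (tendsto_sub_nhds_zero_iff.2 tendsto_id)
  exact hasFDerivAt_iff_isLittleO.2 (hquad.trans_isLittleO hsmall)

end IsVariationalFlow

theorem exists_isVariationalFlow_hasFDerivAt [CompleteSpace E] {f : E → E} {x₀ : E}
    (hf : ContDiffAt ℝ 2 f x₀) {U : Set E} (hU : U ∈ 𝓝 x₀) :
    ∃ δ > 0, ∃ α J, IsVariationalFlow f x₀ δ α J ∧
      (∀ y ∈ ball x₀ δ, ∀ t ∈ Ioo (-δ) δ, α y t ∈ U) ∧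
      ∀ t ∈ Ioo (-δ) δ, HasFDerivAt (fun y => α y t) (J t) x₀ := by
  have hf' : ContDiffAt ℝ 1 (fderiv ℝ f) x₀ := hf.fderiv_right (by norm_num)
  obtain ⟨K, s, hs, hK⟩ := hf'.exists_lipschitzOnWith
  have hbounded : ∀ᶠ y in 𝓝 x₀, ‖fderiv ℝ f y‖ < ‖fderiv ℝ f x₀‖ + 1 :=
    hf'.continuousAt.norm.eventually_lt continuousAt_const (by simp)
  have hdiff : ∀ᶠ y in 𝓝 x₀, DifferentiableAt ℝ f y :=
    (hf.eventually (by simp)).mono fun y hy => hy.differentiableAt (by norm_num)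
  obtain ⟨R, hR, hball⟩ := Metric.eventually_nhds_iff_ball.1
    ((hbounded.and hdiff).and (inter_mem hs hU))
  obtain ⟨δ, hδ, α, J, h⟩ := exists_isVariationalFlow hf
  obtain ⟨η, hη, hηδ, hα⟩ := h.exists_forall_mem hδ (ball_mem_nhds x₀ hR)
  refine ⟨η, hη, α, J, h.mono hηδ, fun y hy t ht => (hball _ (hα y hy t ht)).2.2, fun t ht => ?_⟩
  exact (h.mono hηδ).hasFDerivAt_flow hη (convex_ball x₀ R) (fun y hy => (hball y hy).1.2)
    (hK.mono fun y hy => (hball y hy).2.1) (fun y hy => (hball y hy).1.1.le) hα ht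

end VariationalEquation

/-! ### Flows of vector fields in charts -/

section FlowOfVectorField

open Filter Set Topology

variable {E : Type*} [NormedAddCommGroup E] [NormedSpace ℝ E]
  {M : Type*} [TopologicalSpace M] [ChartedSpace E M] {X : ∀ x : M, TangentSpace 𝓘(ℝ, E) x}

theorem flow_zero (X : ∀ x : M, TangentSpace 𝓘(ℝ, E) x) (x : M) : flow X 0 x = x := by
  rw [flow]
  split_ifs with h
  · obtain ⟨-, -, -, -, h0, -⟩ := h.choose_spec
    exact h0
  · rfl

theorem hasDerivAt_comp_of_isMIntegralCurveAt {V : Type*} [NormedAddCommGroup V]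
    [NormedSpace ℝ V] {f : M → V} {γ : ℝ → M} {t : ℝ}
    (hf : MDifferentiableAt 𝓘(ℝ, E) 𝓘(ℝ, V) f (γ t)) (hγ : IsMIntegralCurveAt γ X t) :
    HasDerivAt (fun s => f (γ s)) (mfderiv 𝓘(ℝ, E) 𝓘(ℝ, V) f (γ t) (X (γ t))) t := by
  have h : HasFDerivAt (fun s => f (γ s)) (_ : ℝ →L[ℝ] V) t :=
    (hf.hasMFDerivAt.comp t hγ.hasMFDerivAt).hasFDerivAt
  refine h.hasDerivAt.congr_deriv ?_
  exact congrArg (mfderiv 𝓘(ℝ, E) 𝓘(ℝ, V) f (γ t)) (one_smul ℝ (X (γ t)))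

section Uniqueness

variable [IsManifold 𝓘(ℝ, E) 1 M] [T2Space M]
  (hX : ContMDiff 𝓘(ℝ, E) 𝓘(ℝ, E).tangent 1 (fun x => (⟨x, X x⟩ : TangentBundle 𝓘(ℝ, E) M)))
include hX

theorem flow_eq {γ : ℝ → M} {a b : ℝ} (hγ : IsMIntegralCurveOn γ X (Ioo a b))
    (h0 : (0 : ℝ) ∈ Ioo a b) {t : ℝ} (ht : t ∈ Ioo a b) : flow X t (γ 0) = γ t := by
  have h : ∃ δ : ℝ → M, ∃ c d : ℝ, (0 : ℝ) ∈ Ioo c d ∧ t ∈ Ioo c d ∧ δ 0 = γ 0 ∧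
      IsMIntegralCurveOn δ X (Ioo c d) := ⟨γ, a, b, h0, ht, rfl, hγ⟩
  rw [flow, dif_pos h]
  obtain ⟨c, d, hc0, hct, hδ0, hδ⟩ := h.choose_spec
  have hinter {s : ℝ} (h1 : s ∈ Ioo a b) (h2 : s ∈ Ioo c d) : s ∈ Ioo (max a c) (min b d) :=
    ⟨max_lt h1.1 h2.1, lt_min h1.2 h2.2⟩
  exact isMIntegralCurveOn_Ioo_eqOn_of_contMDiff_boundaryless (hinter h0 hc0) hX
    (hδ.mono (Ioo_subset_Ioo (le_max_right _ _) (min_le_right _ _)))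
    (hγ.mono (Ioo_subset_Ioo (le_max_left _ _) (min_le_left _ _))) hδ0 (hinter ht hct)

theorem eventually_flow_eq {γ : ℝ → M} (hγ : IsMIntegralCurveAt γ X 0) :
    ∀ᶠ t in 𝓝 0, flow X t (γ 0) = γ t := by
  obtain ⟨ε, hε, hγ⟩ := isMIntegralCurveAt_iff'.1 hγ
  rw [Real.ball_eq_Ioo] at hγ
  have h0 : (0 : ℝ) ∈ Ioo (0 - ε) (0 + ε) := ⟨by linarith, by linarith⟩
  filter_upwards [Ioo_mem_nhds h0.1 h0.2] with t ht using flow_eq hX hγ h0 ht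

theorem isMIntegralCurveAt_flow [CompleteSpace E] (x : M) :
    IsMIntegralCurveAt (fun t => flow X t x) X 0 := by
  obtain ⟨γ, rfl, hγ⟩ := exists_isMIntegralCurveAt_of_contMDiffAt_boundaryless 0 (hX x)
  filter_upwards [hγ, (eventually_flow_eq hX hγ).eventually_nhds] with t ht heq
  have hflow : (fun s => flow X s (γ 0)) =ᶠ[𝓝 t] γ := heq
  have hd := ht.congr_of_eventuallyEq hflow
  rwa [← hflow.eq_of_nhds] at hd

theorem hasDerivAt_comp_flow [CompleteSpace E] {V : Type*} [NormedAddCommGroup V]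
    [NormedSpace ℝ V] {f : M → V} {x : M} (hf : MDifferentiableAt 𝓘(ℝ, E) 𝓘(ℝ, V) f x) :
    HasDerivAt (fun t => f (flow X t x)) (mfderiv 𝓘(ℝ, E) 𝓘(ℝ, V) f x (X x)) 0 := by
  have h := hasDerivAt_comp_of_isMIntegralCurveAt (f := f) (by rwa [flow_zero])
    (isMIntegralCurveAt_flow hX x)
  rwa [flow_zero] at h

theorem tendsto_flow [CompleteSpace E] (x : M) : Tendsto (fun t => flow X t x) (𝓝 0) (𝓝 x) := by
  simpa only [ContinuousAt, flow_zero] using (isMIntegralCurveAt_flow hX x).continuousAt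

end Uniqueness

/-- The expression of the vector field `X` in the chart at `x₀`, as a map of the model space. -/
def chartField (x₀ : M) (X : ∀ x : M, TangentSpace 𝓘(ℝ, E) x) : E → E :=
  VectorField.mpullbackWithin 𝓘(ℝ, E) 𝓘(ℝ, E) (extChartAt 𝓘(ℝ, E) x₀).symm X (range 𝓘(ℝ, E))

section ChartField

variable [IsManifold 𝓘(ℝ, E) 1 M] {x₀ : M}

theorem chartField_apply {z : E} (hz : z ∈ (extChartAt 𝓘(ℝ, E) x₀).target) :
    chartField x₀ X z = mfderiv 𝓘(ℝ, E) 𝓘(ℝ, E) (extChartAt 𝓘(ℝ, E) x₀)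
      ((extChartAt 𝓘(ℝ, E) x₀).symm z) (X ((extChartAt 𝓘(ℝ, E) x₀).symm z)) := by
  have hleft := mfderiv_extChartAt_comp_mfderivWithin_extChartAt_symm (I := 𝓘(ℝ, E)) hz
  have hright := mfderivWithin_extChartAt_symm_comp_mfderiv_extChartAt (I := 𝓘(ℝ, E)) hz
  change (mfderivWithin 𝓘(ℝ, E) 𝓘(ℝ, E) (extChartAt 𝓘(ℝ, E) x₀).symm
    (range 𝓘(ℝ, E)) z).inverse _ = _
  rw [ContinuousLinearMap.inverse_eq hright hleft]
  rfl

theorem chartField_extChartAt {y : M} (hy : y ∈ (extChartAt 𝓘(ℝ, E) x₀).source) :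
    chartField x₀ X (extChartAt 𝓘(ℝ, E) x₀ y) =
      mfderiv 𝓘(ℝ, E) 𝓘(ℝ, E) (extChartAt 𝓘(ℝ, E) x₀) y (X y) := by
  rw [chartField_apply ((extChartAt 𝓘(ℝ, E) x₀).map_source hy),
    (extChartAt 𝓘(ℝ, E) x₀).left_inv hy]

theorem chartField_self : chartField x₀ X (extChartAt 𝓘(ℝ, E) x₀ x₀) = X x₀ := by
  rw [chartField_extChartAt (mem_extChartAt_source _), mfderiv_extChartAt_self]
  rfl

theorem mlieBracket_eq_chartField (X Y : ∀ x : M, TangentSpace 𝓘(ℝ, E) x) :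
    VectorField.mlieBracket 𝓘(ℝ, E) X Y x₀ =
      fderiv ℝ (chartField x₀ Y) (extChartAt 𝓘(ℝ, E) x₀ x₀) (X x₀) -
        fderiv ℝ (chartField x₀ X) (extChartAt 𝓘(ℝ, E) x₀ x₀) (Y x₀) := by
  have hinv : (show E →L[ℝ] E from
      mfderiv 𝓘(ℝ, E) 𝓘(ℝ, E) (extChartAt 𝓘(ℝ, E) x₀) x₀).inverse =
        ContinuousLinearMap.id ℝ E := by
    have : (show E →L[ℝ] E from mfderiv 𝓘(ℝ, E) 𝓘(ℝ, E) (extChartAt 𝓘(ℝ, E) x₀) x₀) =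
      ContinuousLinearMap.id ℝ E := mfderiv_extChartAt_self
    rw [this, ContinuousLinearMap.inverse_id]
  rw [← VectorField.mlieBracketWithin_univ, VectorField.mlieBracketWithin_apply]
  refine (congrArg (fun L : E →L[ℝ] E => L _) hinv).trans ?_
  change VectorField.lieBracketWithin ℝ (chartField x₀ X) (chartField x₀ Y)
    ((extChartAt 𝓘(ℝ, E) x₀).symm ⁻¹' univ ∩ range 𝓘(ℝ, E)) (extChartAt 𝓘(ℝ, E) x₀ x₀) = _
  rw [preimage_univ, univ_inter, modelWithCornersSelf_coe, range_id,
    VectorField.lieBracketWithin_univ, VectorField.lieBracket, chartField_self, chartField_self]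

theorem mfderivWithin_extChartAt_symm_chartField {z : E}
    (hz : z ∈ (extChartAt 𝓘(ℝ, E) x₀).target) :
    mfderivWithin 𝓘(ℝ, E) 𝓘(ℝ, E) (extChartAt 𝓘(ℝ, E) x₀).symm (range 𝓘(ℝ, E)) z
      (chartField x₀ X z : E) = X ((extChartAt 𝓘(ℝ, E) x₀).symm z) := by
  rw [chartField_apply hz]
  exact congrArg (fun L => L (X ((extChartAt 𝓘(ℝ, E) x₀).symm z)))
    (mfderivWithin_extChartAt_symm_comp_mfderiv_extChartAt (I := 𝓘(ℝ, E)) hz)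

theorem isMIntegralCurveOn_extChartAt_symm {c : ℝ → E} {s : Set ℝ}
    (hc : ∀ t ∈ s, HasDerivAt c (chartField x₀ X (c t)) t)
    (hmem : ∀ t ∈ s, c t ∈ (extChartAt 𝓘(ℝ, E) x₀).target) :
    IsMIntegralCurveOn (fun t => (extChartAt 𝓘(ℝ, E) x₀).symm (c t)) X s := by
  intro t ht
  have hsymm : HasMFDerivAt 𝓘(ℝ, E) 𝓘(ℝ, E) (extChartAt 𝓘(ℝ, E) x₀).symm (c t) _ :=
    (mdifferentiableWithinAt_extChartAt_symm (hmem t ht)).hasMFDerivWithinAt.hasMFDerivAt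
      (by simp)
  refine ((hsymm.comp t (hc t ht).hasFDerivAt.hasMFDerivAt).congr_mfderiv ?_).hasMFDerivWithinAt
  refine ContinuousLinearMap.ext fun a => ?_
  exact (map_smul (mfderivWithin 𝓘(ℝ, E) 𝓘(ℝ, E) (extChartAt 𝓘(ℝ, E) x₀).symm
    (range 𝓘(ℝ, E)) (c t)) (show ℝ from a) _).trans
      (congrArg (fun w : E => (show ℝ from a) • w)
        (mfderivWithin_extChartAt_symm_chartField (hmem t ht)))

/-- The chart at `x₀` has differential the identity at `x₀`, so that only the chart at `g x₀`
appears on the left. -/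
theorem mfderiv_extChartAt_comp_mfderiv_eq {g : M → M} {a : E → E} {A : E →L[ℝ] E}
    (hg : g =ᶠ[𝓝 x₀] fun y =>
      (extChartAt 𝓘(ℝ, E) x₀).symm (a (extChartAt 𝓘(ℝ, E) x₀ y)))
    (ha : HasFDerivAt a A (extChartAt 𝓘(ℝ, E) x₀ x₀))
    (hmem : a (extChartAt 𝓘(ℝ, E) x₀ x₀) ∈ (extChartAt 𝓘(ℝ, E) x₀).target) :
    (mfderiv 𝓘(ℝ, E) 𝓘(ℝ, E) (extChartAt 𝓘(ℝ, E) x₀) (g x₀)).comp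
      (mfderiv 𝓘(ℝ, E) 𝓘(ℝ, E) g x₀) = A := by
  let φ := extChartAt 𝓘(ℝ, E) x₀
  have hφ : HasMFDerivAt 𝓘(ℝ, E) 𝓘(ℝ, E) φ x₀ (ContinuousLinearMap.id ℝ E) := by
    have := (mdifferentiableAt_extChartAt (I := 𝓘(ℝ, E)) (mem_chart_source E x₀)).hasMFDerivAt
    rwa [mfderiv_extChartAt_self] at this
  have haφ : HasMFDerivAt 𝓘(ℝ, E) 𝓘(ℝ, E) (fun y => a (φ y)) x₀ A :=
    HasMFDerivAt.comp x₀ ha.hasMFDerivAt hφ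
  have hsymm : MDifferentiableAt 𝓘(ℝ, E) 𝓘(ℝ, E) φ.symm (a (φ x₀)) :=
    (mdifferentiableWithinAt_extChartAt_symm hmem).mdifferentiableAt (by simp)
  have hgd : MDifferentiableAt 𝓘(ℝ, E) 𝓘(ℝ, E) g x₀ :=
    (hsymm.comp x₀ haφ.mdifferentiableAt).congr_of_eventuallyEq hg
  have hφg : MDifferentiableAt 𝓘(ℝ, E) 𝓘(ℝ, E) φ (g x₀) := by
    refine mdifferentiableAt_extChartAt (extChartAt_source 𝓘(ℝ, E) x₀ ▸ ?_)
    rw [hg.eq_of_nhds]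
    exact φ.map_target hmem
  have heq : φ ∘ g =ᶠ[𝓝 x₀] fun y => a (φ y) := by
    have htarget : ∀ᶠ y in 𝓝 x₀, a (φ y) ∈ φ.target :=
      haφ.continuousAt.eventually ((isOpen_extChartAt_target x₀).mem_nhds hmem)
    filter_upwards [hg, htarget] with y hy hyt
    rw [Function.comp_apply, hy]
    exact φ.right_inv hyt
  exact hasMFDerivAt_unique (hφg.hasMFDerivAt.comp x₀ hgd.hasMFDerivAt)
    (haφ.congr_of_eventuallyEq heq)

/-- The tangent map of the flow of `X` along the integral curve through `x`, read in the chart at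
`x`: the linear map of the model space induced by `T_x Φ_X^t`. -/
def chartTangentFlow (X : ∀ x : M, TangentSpace 𝓘(ℝ, E) x) (x : M) (t : ℝ) : E →L[ℝ] E :=
  (mfderiv 𝓘(ℝ, E) 𝓘(ℝ, E) (extChartAt 𝓘(ℝ, E) x) (flow X t x)).comp
    (mfderiv 𝓘(ℝ, E) 𝓘(ℝ, E) (flow X t) x)

theorem chartTangentFlow_zero (X : ∀ x : M, TangentSpace 𝓘(ℝ, E) x) (x : M) :
    chartTangentFlow X x 0 = ContinuousLinearMap.id ℝ E := by
  have hid : flow X 0 = id := funext (flow_zero X)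
  rw [chartTangentFlow, hid, mfderiv_id]
  exact mfderiv_extChartAt_self

end ChartField

variable [CompleteSpace E] [IsManifold 𝓘(ℝ, E) ∞ M]

theorem contDiffAt_chartField {m : ℕ∞}
    (hX : ContMDiff 𝓘(ℝ, E) 𝓘(ℝ, E).tangent m (fun x => (⟨x, X x⟩ : TangentBundle 𝓘(ℝ, E) M)))
    (x₀ : M) : ContDiffAt ℝ m (chartField x₀ X) (extChartAt 𝓘(ℝ, E) x₀ x₀) := by
  have h := VectorField.contMDiffWithinAt_mpullbackWithin_extChartAt_symm (n := ∞)
    (hX x₀).contMDiffWithinAt uniqueMDiffOn_univ (mem_univ x₀) (mod_cast le_top)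
  rw [preimage_univ, inter_univ] at h
  exact contMDiffAt_vectorSpace_iff_contDiffAt.1 (h.contMDiffAt (extChartAt_target_mem_nhds x₀))

theorem hasDerivAt_chartTangentFlow_zero [T2Space M]
    (hX : ContMDiff 𝓘(ℝ, E) 𝓘(ℝ, E).tangent 2 (fun x => (⟨x, X x⟩ : TangentBundle 𝓘(ℝ, E) M)))
    (x : M) : HasDerivAt (chartTangentFlow X x)
      (fderiv ℝ (chartField x X) (extChartAt 𝓘(ℝ, E) x x)) 0 := by
  let φ := extChartAt 𝓘(ℝ, E) x
  obtain ⟨δ, hδ, α, J, hα, hmem, hJ⟩ := exists_isVariationalFlow_hasFDerivAt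
    (contDiffAt_chartField (m := 2) hX x) (extChartAt_target_mem_nhds (I := 𝓘(ℝ, E)) x)
  have h0 : (0 : ℝ) ∈ Ioo (-δ) δ := ⟨neg_lt_zero.2 hδ, hδ⟩
  have hflow : ∀ y ∈ Metric.ball (φ x) δ, ∀ t ∈ Ioo (-δ) δ,
      flow X t (φ.symm y) = φ.symm (α y t) := by
    intro y hy t ht
    have h := flow_eq (hX.of_le (by norm_num)) (isMIntegralCurveOn_extChartAt_symm
      (hα.hasDerivAt_flow y hy) (hmem y hy)) h0 ht
    rwa [hα.flow_zero y hy] at h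
  have hchart : ∀ᶠ y in 𝓝 x, φ y ∈ Metric.ball (φ x) δ :=
    (continuousAt_extChartAt x).eventually (Metric.ball_mem_nhds _ hδ)
  refine (hα.hasDerivAt_variation_zero hδ).congr_of_eventuallyEq ?_
  filter_upwards [Ioo_mem_nhds h0.1 h0.2] with t ht
  refine mfderiv_extChartAt_comp_mfderiv_eq ?_ (hJ t ht)
    (hmem _ (Metric.mem_ball_self hδ) t ht)
  filter_upwards [hchart, extChartAt_source_mem_nhds (I := 𝓘(ℝ, E)) x] with y hy hys
  have h := hflow _ hy t ht
  rwa [φ.left_inv hys] at h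

end FlowOfVectorField

/-! ### Multilinear maps and chart frames -/

section Multilinear

theorem multilinearMap_eq_sum_basis {R N N₂ ι κ : Type*} [CommSemiring R] [AddCommMonoid N]
    [Module R N] [AddCommMonoid N₂] [Module R N₂] [Fintype ι] [Fintype κ] [DecidableEq ι]
    (b : Module.Basis κ R N) (f : MultilinearMap R (fun _ : ι => N) N₂) (v : ι → N) :
    f v = ∑ a : ι → κ, (∏ i, b.coord (a i) (v i)) • f (fun i => b (a i)) := by
  conv_lhs => rw [← funext fun i => b.sum_repr (v i)]
  simp only [MultilinearMap.map_sum, MultilinearMap.map_smul_univ, Module.Basis.coord_apply]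

variable {E V ι : Type*} [NormedAddCommGroup E] [NormedSpace ℝ E] [FiniteDimensional ℝ E]
  [NormedAddCommGroup V] [NormedSpace ℝ V] [Fintype ι] [DecidableEq ι]

theorem hasDerivAt_multilinearMap_apply {f : ℝ → MultilinearMap ℝ (fun _ : ι => E) V}
    {f' : (ι → E) → V} {u : ℝ → ι → E} {u' : ι → E} {t : ℝ}
    (hf : ∀ v, HasDerivAt (fun s => f s v) (f' v) t) (hu : ∀ i, HasDerivAt (u · i) (u' i) t) :
    HasDerivAt (fun s => f s (u s))
      (f' (u t) + ∑ i, f t (Function.update (u t) i (u' i))) t := by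
  let b := Module.finBasis ℝ E
  let m (a : ι → Fin (Module.finrank ℝ E)) : ContinuousMultilinearMap ℝ (fun _ : ι => E) ℝ :=
    (ContinuousMultilinearMap.mkPiAlgebra ℝ ι ℝ).compContinuousLinearMap
      (fun i => LinearMap.toContinuousLinearMap (b.coord (a i)))
  have expand (s : ℝ) (v : ι → E) : f s v = ∑ a, m a v • f s (fun i => b (a i)) :=
    multilinearMap_eq_sum_basis b (f s) v
  have hm (a) : HasDerivAt (fun s => m a (u s)) (∑ i, m a (Function.update (u t) i (u' i))) t :=
    (((m a).hasFDerivAt (u t)).comp_hasDerivAt t (hasDerivAt_pi.2 hu)).congr_deriv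
      ((m a).linearDeriv_apply (u t) u')
  have f'_expand : f' (u t) = ∑ a, m a (u t) • f' (fun i => b (a i)) := by
    refine (hf (u t)).unique ?_
    simp_rw [expand _ (u t)]
    exact HasDerivAt.fun_sum fun a _ => (hf fun i => b (a i)).const_smul (m a (u t))
  rw [funext fun s => expand s (u s)]
  refine (HasDerivAt.fun_sum fun a _ => (hm a).smul (hf (fun i => b (a i)))).congr_deriv ?_
  rw [Finset.sum_add_distrib, ← f'_expand, Finset.sum_congr rfl fun i _ => expand t _,
    Finset.sum_comm]
  simp only [Finset.sum_smul]

end Multilinear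

section SmoothVF

open Filter Topology

variable {E : Type*} [NormedAddCommGroup E] [NormedSpace ℝ E]
  {M : Type*} [TopologicalSpace M] [ChartedSpace E M] [IsManifold 𝓘(ℝ, E) ∞ M]

/-- The Lie bracket of smooth vector fields, as a smooth vector field. -/
def SmoothVF.lieBracket [CompleteSpace E] (X Y : SmoothVF E M) : SmoothVF E M where
  toFun := VectorField.mlieBracket 𝓘(ℝ, E) X Y
  contMDiff_toFun x := by
    have : IsManifold 𝓘(ℝ, E) (minSmoothness ℝ 2) M := by
      rw [minSmoothness_of_isRCLikeNormedField]
      exact IsManifold.of_le (n := ∞) (by norm_cast)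
    have : IsManifold 𝓘(ℝ, E) (((⊤ : ℕ∞) : WithTop ℕ∞) + 1) M :=
      inferInstanceAs (IsManifold 𝓘(ℝ, E) ∞ M)
    exact ContMDiffAt.mlieBracket_vectorField (m := ⊤) (n := ⊤) (X.contMDiff x) (Y.contMDiff x)
      (by simp [minSmoothness_of_isRCLikeNormedField])

/-- A family `e v` of smooth vector fields depending linearly on `v ∈ E` such that, near `x₀`, `e v`
is the vector field with the constant expression `v` in the chart at `x₀`. -/
def IsChartFrame (x₀ : M) (e : E →ₗ[ℝ] SmoothVF E M) : Prop :=
  ∀ᶠ y in 𝓝 x₀, ∀ w : TangentSpace 𝓘(ℝ, E) y,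
    e (mfderiv 𝓘(ℝ, E) 𝓘(ℝ, E) (extChartAt 𝓘(ℝ, E) x₀) y w) y = w

theorem IsChartFrame.apply_self {x₀ : M} {e : E →ₗ[ℝ] SmoothVF E M} (he : IsChartFrame x₀ e)
    (w : TangentSpace 𝓘(ℝ, E) x₀) : e w x₀ = w := by
  have h := he.self_of_nhds w
  rwa [mfderiv_extChartAt_self] at h

variable [FiniteDimensional ℝ E] [T2Space M]

theorem exists_isChartFrame (x₀ : M) : ∃ e : E →ₗ[ℝ] SmoothVF E M, IsChartFrame x₀ e := by
  obtain ⟨χ⟩ : Nonempty (SmoothBumpFunction 𝓘(ℝ, E) x₀) := inferInstance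
  let T := trivializationAt E (TangentSpace 𝓘(ℝ, E) : M → Type _) x₀
  have hbase : T.baseSet = (chartAt E x₀).source := TangentBundle.trivializationAt_baseSet x₀
  have hsmooth (v : E) : ContMDiff 𝓘(ℝ, E) (𝓘(ℝ, E).prod 𝓘(ℝ, E)) ∞
      (fun y => (⟨y, ((χ : M → ℝ) • fun y => T.symmL ℝ y v) y⟩ :
        Bundle.TotalSpace E (TangentSpace 𝓘(ℝ, E) : M → Type _))) := by
    refine ContMDiffOn.smul_section_of_tsupport (u := T.baseSet) χ.contMDiff.contMDiffOn
      T.open_baseSet (hbase ▸ χ.tsupport_subset_chartAt_source)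
      ((T.contMDiffOn_section_baseSet_iff (IB := 𝓘(ℝ, E)) (n := ∞)).2
        ((contMDiffOn_const (c := v)).congr fun y hy => ?_))
    simp only [T.symmL_apply (R := ℝ) hy, T.apply_mk_symm hy]
  let e : E →ₗ[ℝ] SmoothVF E M :=
    { toFun v := ⟨(χ : M → ℝ) • fun y => T.symmL ℝ y v, hsmooth v⟩
      map_add' v w := by
        ext y
        exact (congrArg (χ y • ·) (map_add (T.symmL ℝ y) v w)).trans (smul_add _ _ _)
      map_smul' c v := by
        ext y
        exact (congrArg (χ y • ·) (map_smul (T.symmL ℝ y) c v)).trans (smul_comm _ _ _) }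
  refine ⟨e, ?_⟩
  filter_upwards [χ.eventuallyEq_one, chart_source_mem_nhds E x₀] with y hχ hy w
  have hT := T.symmL_continuousLinearMapAt (R := ℝ) (hbase ▸ hy : y ∈ T.baseSet) w
  rw [TangentBundle.continuousLinearMapAt_trivializationAt (I := 𝓘(ℝ, E)) (𝕜 := ℝ) hy] at hT
  change χ y • T.symmL ℝ y _ = w
  rw [hχ]
  exact (one_smul ℝ _).trans hT

theorem SmoothVF.exists_apply_eq (x : M) (w : TangentSpace 𝓘(ℝ, E) x) :
    ∃ Y : SmoothVF E M, Y x = w :=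
  let ⟨e, he⟩ := exists_isChartFrame (E := E) x
  ⟨e w, he.apply_self w⟩

end SmoothVF

/-! ### Horizontal lifts and sections of the associated bundle -/

section AssociatedBundle

open Filter Topology

variable
  {F : Type*} [NormedAddCommGroup F] [NormedSpace ℝ F]
  {G : Type*} [TopologicalSpace G] [ChartedSpace F G] [Group G] [LieGroup 𝓘(ℝ, F) ∞ G]
  {E : Type*} [NormedAddCommGroup E] [NormedSpace ℝ E]
  {M : Type*} [TopologicalSpace M] [ChartedSpace E M] [IsManifold 𝓘(ℝ, E) ∞ M]
  {B : Type*} [NormedAddCommGroup B] [NormedSpace ℝ B]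
  {P : Type*} [TopologicalSpace P] [ChartedSpace B P] [IsManifold 𝓘(ℝ, B) ∞ P]
  {V : Type*} [NormedAddCommGroup V] [NormedSpace ℝ V]
  {Q : PrincipalBundle F G E M B P} {ρ : Representation ℝ G V}

/-- The linear map `z ↦ p \ z` from the fibre over `x` to `V`, for `p ∈ P_x`. -/
def Assoc.coordLinear {x : M} (p : Q.Fiber x) : Assoc Q ρ x →ₗ[ℝ] V where
  toFun := Assoc.coord p
  map_add' := Assoc.coord_add p
  map_smul' := Assoc.coord_smul p

/-- The map `totalCoord q` on the fibre over `x`, as a linear map; it is zero unless `q ∈ P_x`. -/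
def totalCoordLinear (Q : PrincipalBundle F G E M B P) (ρ : Representation ℝ G V) (q : P) (x : M) :
    Assoc Q ρ x →ₗ[ℝ] V where
  toFun z := totalCoord q ⟨x, z⟩
  map_add' z w := by
    unfold totalCoord
    split_ifs
    exacts [Assoc.coord_add _ z w, (add_zero 0).symm]
  map_smul' c z := by
    unfold totalCoord
    split_ifs
    exacts [Assoc.coord_smul _ c z, (smul_zero c).symm]

variable {s : ∀ x : M, Assoc Q ρ x}

theorem sectionFun_eq_coord (s : ∀ x : M, Assoc Q ρ x) {x : M} (p : Q.Fiber x) :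
    sectionFun s p.1 = Assoc.coord p (s x) := by
  obtain ⟨p, rfl⟩ := p
  rfl

theorem totalCoord_eq_sectionFun (s : ∀ x : M, Assoc Q ρ x) {q : P} {x : M} (h : Q.proj q = x) :
    totalCoord q ⟨x, s x⟩ = sectionFun s q :=
  (dif_pos h).trans (sectionFun_eq_coord s ⟨q, h⟩).symm

theorem sectionFun_act (s : ∀ x : M, Assoc Q ρ x) (p : P) (g : G) :
    sectionFun s (Q.act p g) = ρ g⁻¹ (sectionFun s p) := by
  let pg : Q.Fiber (Q.proj p) := ⟨Q.act p g, Q.proj_act p g⟩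
  have hdiv : Q.div pg (Q.self p) = g⁻¹ := Q.div_eq _ _ <| by
    rw [← Q.act_mul, mul_inv_cancel, Q.act_one]
    rfl
  rw [sectionFun_eq_coord s pg, Assoc.coord_eq pg (Q.self p), hdiv]
  rfl

theorem IsSmoothSection.sub {t : ∀ x : M, Assoc Q ρ x} (hs : IsSmoothSection s)
    (ht : IsSmoothSection t) : IsSmoothSection (fun x => s x - t x) :=
  (ContMDiff.sub hs ht).congr fun p => map_sub (Assoc.coordLinear (Q.self p)) _ _

theorem IsSmoothSection.sum {ι : Type*} {S : Finset ι} {s : ι → ∀ x : M, Assoc Q ρ x}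
    (hs : ∀ i ∈ S, IsSmoothSection (s i)) : IsSmoothSection (fun x => ∑ i ∈ S, s i x) :=
  (contMDiff_finsetSum hs).congr fun p => map_sum (Assoc.coordLinear (Q.self p)) _ _

theorem IsSmoothSection.mdifferentiableAt (hs : IsSmoothSection s) (p : P) :
    MDifferentiableAt 𝓘(ℝ, B) 𝓘(ℝ, V) (sectionFun s) p :=
  (hs p).mdifferentiableAt (by simp)

theorem PrincipalBundle.mdifferentiableAt_act (Q : PrincipalBundle F G E M B P) (g : G) (p : P) :
    MDifferentiableAt 𝓘(ℝ, B) 𝓘(ℝ, B) (fun q => Q.act q g) p :=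
  (Q.smooth_act.comp (contMDiff_id.prodMk contMDiff_const)).contMDiffAt.mdifferentiableAt (by simp)

namespace PrincipalConnection

variable (A : PrincipalConnection Q)

theorem base_horizontalLift (X : ∀ x : M, TangentSpace 𝓘(ℝ, E) x) :
    Q.base (A.horizontalLift X) = X := by
  have base_at {x : M} (p : Q.Fiber x) :
      (p.2 ▸ mfderiv 𝓘(ℝ, B) 𝓘(ℝ, E) Q.proj p.1 (A.horizontalLift X p.1) :
        TangentSpace 𝓘(ℝ, E) x) = X x := by
    obtain ⟨p, rfl⟩ := p
    exact A.proj_lift p _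
  exact funext fun x => base_at (Q.point x)

section CovariantDerivative

variable (hρ : ∀ g, Continuous (ρ g))
include hρ

theorem mfderiv_sectionFun_act (X : ∀ x : M, TangentSpace 𝓘(ℝ, E) x) (hs : IsSmoothSection s)
    (p : P) (g : G) :
    (mfderiv 𝓘(ℝ, B) 𝓘(ℝ, V) (sectionFun s) (Q.act p g) (A.horizontalLift X (Q.act p g)) : V) =
      ρ g⁻¹ (mfderiv 𝓘(ℝ, B) 𝓘(ℝ, V) (sectionFun s) p (A.horizontalLift X p) : V) := by
  let R : V →L[ℝ] V := ⟨ρ g⁻¹, hρ g⁻¹⟩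
  have deriv_act := HasMFDerivAt.comp p (hs.mdifferentiableAt (Q.act p g)).hasMFDerivAt
    (Q.mdifferentiableAt_act g p).hasMFDerivAt
  have deriv_rep := HasMFDerivAt.comp p R.hasMFDerivAt (hs.mdifferentiableAt p).hasMFDerivAt
  have equivariant : sectionFun s ∘ (fun q => Q.act q g) = R ∘ sectionFun s :=
    funext fun q => sectionFun_act s q g
  rw [equivariant] at deriv_act
  exact (congrArg _ (A.equivariant X p g)).trans
    (congrArg (fun L => L (A.horizontalLift X p)) (hasMFDerivAt_unique deriv_act deriv_rep))

theorem coord_nabla (X : ∀ x : M, TangentSpace 𝓘(ℝ, E) x) (hs : IsSmoothSection s) {x : M}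
    (p : Q.Fiber x) :
    Assoc.coord p (A.nabla X s x) =
      mfderiv 𝓘(ℝ, B) 𝓘(ℝ, V) (sectionFun s) p.1 (A.horizontalLift X p.1) := by
  have h := A.mfderiv_sectionFun_act hρ X hs (Q.point x).1 (Q.div (Q.point x) p)
  have hinv : (Q.div (Q.point x) p)⁻¹ = Q.div p (Q.point x) := by
    rw [inv_eq_iff_mul_eq_one, Q.div_mul_div, Q.div_self]
  rw [Q.act_div, hinv] at h
  exact h.symm

theorem isSmoothSection_nabla (X : SmoothVF E M) (hs : IsSmoothSection s) :
    IsSmoothSection (A.nabla X s) := by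
  have smooth_tangentMap : ContMDiff 𝓘(ℝ, B).tangent 𝓘(ℝ, V).tangent ∞
      (tangentMap 𝓘(ℝ, B) 𝓘(ℝ, V) (sectionFun s)) :=
    ContMDiff.contMDiff_tangentMap hs (by simp)
  exact ((contMDiff_snd_tangentBundle_modelSpace V 𝓘(ℝ, V) (n := ∞)).comp
    (smooth_tangentMap.comp (A.smooth X))).congr fun p => A.coord_nabla hρ X hs (Q.self p)

variable [CompleteSpace B] [T2Space P]

theorem hasDerivAt_sectionFun_flow (Z : SmoothVF E M) (hs : IsSmoothSection s) (p : P) :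
    HasDerivAt (fun t => sectionFun s (flow (A.horizontalLift Z) t p))
      (Assoc.coord (Q.self p) (A.nabla Z s (Q.proj p))) 0 := by
  rw [A.coord_nabla hρ Z hs]
  exact hasDerivAt_comp_flow ((A.smooth Z).of_le (by simp)) (hs.mdifferentiableAt p)

end CovariantDerivative

variable [CompleteSpace B] [T2Space P] [T2Space M]

theorem eventually_proj_flow (Z : SmoothVF E M) (p : P) :
    ∀ᶠ t in 𝓝 (0 : ℝ), Q.proj (flow (A.horizontalLift Z) t p) = flow Z t (Q.proj p) := by
  have lifted : IsMIntegralCurveAt (fun t => flow (A.horizontalLift Z) t p)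
      (A.horizontalLift Z) 0 :=
    isMIntegralCurveAt_flow ((A.smooth Z).of_le (by simp)) p
  have projected : IsMIntegralCurveAt (fun t => Q.proj (flow (A.horizontalLift Z) t p)) Z 0 := by
    filter_upwards [lifted] with t ht
    have hproj := (Q.smooth_proj (flow (A.horizontalLift Z) t p)).mdifferentiableAt (by simp)
    refine (hproj.hasMFDerivAt.comp t ht).congr_mfderiv (ContinuousLinearMap.ext fun c => ?_)
    exact (map_smul (mfderiv 𝓘(ℝ, B) 𝓘(ℝ, E) Q.proj _) (show ℝ from c) _).trans
      (congrArg (fun w : E => (show ℝ from c) • w) (A.proj_lift _ _))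
  filter_upwards [eventually_flow_eq (Z.contMDiff.of_le (by simp)) projected] with t ht
  rw [← ht, flow_zero]

end PrincipalConnection

end AssociatedBundle

/-! ### The Leibniz formula -/

theorem hasDerivAt_chartField_flow
    {E : Type*} [NormedAddCommGroup E] [NormedSpace ℝ E] [CompleteSpace E]
    {M : Type*} [TopologicalSpace M] [T2Space M] [ChartedSpace E M] [IsManifold 𝓘(ℝ, E) ∞ M]
    (X Y : SmoothVF E M) (x : M) :
    HasDerivAt (fun t => chartField x Y (extChartAt 𝓘(ℝ, E) x (flow X t x)))
      (fderiv ℝ (chartField x Y) (extChartAt 𝓘(ℝ, E) x x) (X x)) 0 := by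
  have chart_flow := hasDerivAt_comp_flow (X := X) (X.contMDiff.of_le (by simp))
    (mdifferentiableAt_extChartAt (I := 𝓘(ℝ, E)) (mem_chart_source E x))
  rw [mfderiv_extChartAt_self] at chart_flow
  have chart_field := (contDiffAt_chartField Y.contMDiff x).differentiableAt (by simp)
  refine HasFDerivAt.comp_hasDerivAt (0 : ℝ) ?_ chart_flow
  rw [flow_zero]
  exact chart_field.hasFDerivAt

theorem hasDerivAt_chartTangentFlow_apply
    {E : Type*} [NormedAddCommGroup E] [NormedSpace ℝ E] [FiniteDimensional ℝ E]
    {M : Type*} [TopologicalSpace M] [T2Space M] [ChartedSpace E M] [IsManifold 𝓘(ℝ, E) ∞ M]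
    (X : SmoothVF E M) (x : M) (v : E) :
    HasDerivAt (fun t => chartTangentFlow X x t v)
      (fderiv ℝ (chartField x X) (extChartAt 𝓘(ℝ, E) x x) v) 0 :=
  ((hasDerivAt_chartTangentFlow_zero (X.contMDiff.of_le (by norm_cast)) x).clm_apply
    (hasDerivAt_const 0 v)).congr_deriv (by rw [map_zero, add_zero])

section MainComputation

open Filter Topology

variable
  {F : Type*} [NormedAddCommGroup F] [NormedSpace ℝ F]
  {G : Type*} [TopologicalSpace G] [ChartedSpace F G] [Group G] [LieGroup 𝓘(ℝ, F) ∞ G]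
  {E : Type*} [NormedAddCommGroup E] [NormedSpace ℝ E]
  {M : Type*} [TopologicalSpace M] [ChartedSpace E M] [IsManifold 𝓘(ℝ, E) ∞ M]
  {B : Type*} [NormedAddCommGroup B] [NormedSpace ℝ B]
  {P : Type*} [TopologicalSpace P] [ChartedSpace B P] [IsManifold 𝓘(ℝ, B) ∞ P]
  {V : Type*} [NormedAddCommGroup V] [NormedSpace ℝ V]
  {Q : PrincipalBundle F G E M B P} {ρ : Representation ℝ G V} {k : ℕ}

/-- The value at `q` of the equivariant function of the section `β(e(v_1), …, e(v_k))`, as a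
multilinear map in `v`, for a linear family `e` of vector fields. -/
def AssocForm.frameMap (β : AssocForm Q ρ k) (e : E →ₗ[ℝ] SmoothVF E M) (q : P) :
    MultilinearMap ℝ (fun _ : Fin k => E) V :=
  ((Assoc.coordLinear (Q.self q)).compMultilinearMap
    (β.toFun (Q.proj q)).toMultilinearMap).compLinearMap fun _ =>
      { toFun v := e v (Q.proj q)
        map_add' v w := congrArg (fun X : SmoothVF E M => X (Q.proj q)) (map_add e v w)
        map_smul' c v := congrArg (fun X : SmoothVF E M => X (Q.proj q)) (map_smul e c v) }

theorem AssocForm.frameMap_apply (β : AssocForm Q ρ k) (e : E →ₗ[ℝ] SmoothVF E M) (q : P)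
    (v : Fin k → E) :
    β.frameMap e q v = sectionFun (fun y => β.toFun y (fun i => e (v i) y)) q := rfl

theorem AssocForm.frameMap_eq_coord (β : AssocForm Q ρ k) {p : P} {e : E →ₗ[ℝ] SmoothVF E M}
    (he : IsChartFrame (Q.proj p) e) (v : Fin k → TangentSpace 𝓘(ℝ, E) (Q.proj p)) :
    β.frameMap e p v = Assoc.coord (Q.self p) (β.toFun (Q.proj p) v) :=
  congrArg (fun w => Assoc.coord (Q.self p) (β.toFun (Q.proj p) w))
    (funext fun i => he.apply_self (v i))

theorem AssocForm.coord_update_mlieBracket [CompleteSpace E] (β : AssocForm Q ρ k) {p : P}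
    {e : E →ₗ[ℝ] SmoothVF E M} (he : IsChartFrame (Q.proj p) e) (Z W : SmoothVF E M)
    (y : Fin k → TangentSpace 𝓘(ℝ, E) (Q.proj p)) (i : Fin k) :
    Assoc.coord (Q.self p) (β.toFun (Q.proj p)
        (Function.update y i (VectorField.mlieBracket 𝓘(ℝ, E) Z W (Q.proj p)))) =
      β.frameMap e p (Function.update y i (fderiv ℝ (chartField (Q.proj p) W)
        (extChartAt 𝓘(ℝ, E) (Q.proj p) (Q.proj p)) (Z (Q.proj p)))) -
      β.frameMap e p (Function.update y i (fderiv ℝ (chartField (Q.proj p) Z)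
        (extChartAt 𝓘(ℝ, E) (Q.proj p) (Q.proj p)) (W (Q.proj p)))) := by
  rw [mlieBracket_eq_chartField]
  exact (β.frameMap_eq_coord he _).symm.trans ((β.frameMap e p).map_update_sub _ _ _ _)

theorem AssocForm.bundleMap_ιMulti (β : AssocForm Q ρ k) {x : M}
    (v : Fin k → TangentSpace 𝓘(ℝ, E) x) :
    β.bundleMap x (exteriorPower.ιMulti ℝ k v) = β.toFun x v :=
  exteriorPower.alternatingMapLinearEquiv_apply_ιMulti _ _

namespace PrincipalConnection

variable (A : PrincipalConnection Q)

/-- The Leibniz form `∇_Z (β(Y_1, …, Y_k)) - ∑_i β(Y_1, …, [Z, Y_i], …, Y_k)` of the Lie derivative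
of `β` along `Z`. -/
def leibnizLie (Z : SmoothVF E M) (β : AssocForm Q ρ k) (Y : Fin k → SmoothVF E M) (x : M) :
    Assoc Q ρ x :=
  A.nabla Z (fun y => β.toFun y (fun i => Y i y)) x -
    ∑ i, β.toFun x (Function.update (fun i => Y i x) i
      (VectorField.mlieBracket 𝓘(ℝ, E) Z (Y i) x))

theorem coord_leibnizLie (Z : SmoothVF E M) (β : AssocForm Q ρ k) (Y : Fin k → SmoothVF E M)
    {x : M} (p : Q.Fiber x) :
    Assoc.coord p (A.leibnizLie Z β Y x) =
      Assoc.coord p (A.nabla Z (fun y => β.toFun y (fun i => Y i y)) x) -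
        ∑ i, Assoc.coord p (β.toFun x (Function.update (fun i => Y i x) i
          (VectorField.mlieBracket 𝓘(ℝ, E) Z (Y i) x))) :=
  (map_sub (Assoc.coordLinear p) _ _).trans (congrArg _ (map_sum (Assoc.coordLinear p) _ _))

theorem isSmoothSection_leibnizLie [CompleteSpace E] (hρ : ∀ g, Continuous (ρ g))
    (Z : SmoothVF E M) (β : AssocForm Q ρ k) (Y : Fin k → SmoothVF E M) :
    IsSmoothSection (A.leibnizLie Z β Y) := by
  refine (A.isSmoothSection_nabla hρ Z (β.smooth Y)).sub (IsSmoothSection.sum fun i _ => ?_)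
  convert! β.smooth (Function.update Y i (Z.lieBracket (Y i))) using 3 with x
  funext j
  obtain rfl | hj := eq_or_ne j i
  · simp only [Function.update_self]
    rfl
  · simp only [Function.update_of_ne hj]

theorem darbouxLieCurve_horizontalLift (Z : SmoothVF E M) (β : AssocForm Q ρ k) (p : P) (x : M)
    (w : ⋀[ℝ]^k (TangentSpace 𝓘(ℝ, E) x)) (t : ℝ) :
    darbouxLieCurve (A.horizontalLift Z) (fun y => β.bundleMap y) p ⟨x, w⟩ t =
      totalCoordLinear Q ρ (flow (A.horizontalLift Z) t p) (flow Z t x)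
        (β.bundleMap _ (exteriorPower.map k
          (mfderiv 𝓘(ℝ, E) 𝓘(ℝ, E) (flow Z t) x).toLinearMap w)) := by
  rw [darbouxLieCurve, A.base_horizontalLift]
  rfl

variable [CompleteSpace B] [T2Space P] [T2Space M] {p : P} {e : E →ₗ[ℝ] SmoothVF E M}

theorem eventually_sectionFun_flow_eq_frameMap [CompleteSpace E] (he : IsChartFrame (Q.proj p) e)
    (Z : SmoothVF E M) (β : AssocForm Q ρ k) (Y : Fin k → SmoothVF E M) :
    (fun t => sectionFun (fun y => β.toFun y (fun i => Y i y)) (flow (A.horizontalLift Z) t p))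
      =ᶠ[𝓝 0] fun t => β.frameMap e (flow (A.horizontalLift Z) t p)
        (fun i => chartField (Q.proj p) (Y i)
          (extChartAt 𝓘(ℝ, E) (Q.proj p) (flow Z t (Q.proj p)))) := by
  have hflow := tendsto_flow (Z.contMDiff.of_le (by simp)) (Q.proj p)
  filter_upwards [A.eventually_proj_flow Z p, hflow.eventually he,
    hflow.eventually (extChartAt_source_mem_nhds (I := 𝓘(ℝ, E)) _)] with t hproj hframe hsource
  rw [AssocForm.frameMap_apply, ← totalCoord_eq_sectionFun _ hproj,
    ← totalCoord_eq_sectionFun _ hproj]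
  congr 3
  funext i
  rw [chartField_extChartAt hsource]
  exact (hframe _).symm

theorem eventually_darbouxLieCurve_eq_frameMap [CompleteSpace E] (he : IsChartFrame (Q.proj p) e)
    (Z : SmoothVF E M) (β : AssocForm Q ρ k) (v : Fin k → TangentSpace 𝓘(ℝ, E) (Q.proj p)) :
    darbouxLieCurve (A.horizontalLift Z) (fun y => β.bundleMap y) p
        ⟨Q.proj p, exteriorPower.ιMulti ℝ k v⟩
      =ᶠ[𝓝 0] fun t => β.frameMap e (flow (A.horizontalLift Z) t p)
        (fun i => chartTangentFlow Z (Q.proj p) t (v i)) := by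
  have hflow := tendsto_flow (Z.contMDiff.of_le (by simp)) (Q.proj p)
  filter_upwards [A.eventually_proj_flow Z p, hflow.eventually he] with t hproj hframe
  rw [A.darbouxLieCurve_horizontalLift, exteriorPower.map_apply_ιMulti,
    AssocForm.bundleMap_ιMulti, AssocForm.frameMap_apply, ← totalCoord_eq_sectionFun _ hproj]
  change totalCoord _ _ = _
  congr 3
  funext i
  exact (hframe _).symm

variable [FiniteDimensional ℝ E] (hρ : ∀ g, Continuous (ρ g))
include hρ

omit [T2Space M] in
theorem hasDerivAt_frameMap_flow (Z : SmoothVF E M) (β : AssocForm Q ρ k)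
    (e : E →ₗ[ℝ] SmoothVF E M) (p : P) {u : ℝ → Fin k → E} {v u' : Fin k → E} (hv : u 0 = v)
    (hu : ∀ i, HasDerivAt (u · i) (u' i) 0) :
    HasDerivAt (fun t => β.frameMap e (flow (A.horizontalLift Z) t p) (u t))
      (Assoc.coord (Q.self p)
          (A.nabla Z (fun y => β.toFun y (fun i => e (v i) y)) (Q.proj p)) +
        ∑ i, β.frameMap e p (Function.update v i (u' i))) 0 := by
  subst hv
  have h := hasDerivAt_multilinearMap_apply
    (fun v => A.hasDerivAt_sectionFun_flow hρ Z (β.smooth fun i => e (v i)) p) hu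
    (f := fun t => β.frameMap e (flow (A.horizontalLift Z) t p))
  simpa only [flow_zero] using h

theorem hasDerivAt_darbouxLieCurve_ιMulti (Z : SmoothVF E M) (β : AssocForm Q ρ k)
    (Y : Fin k → SmoothVF E M) {x : M} (p : Q.Fiber x) :
    HasDerivAt (darbouxLieCurve (A.horizontalLift Z) (fun y => β.bundleMap y) p.1
      ⟨x, exteriorPower.ιMulti ℝ k (fun i => Y i x)⟩)
      (Assoc.coord p (A.leibnizLie Z β Y x)) 0 := by
  obtain ⟨p, rfl⟩ := p
  have := FiniteDimensional.complete ℝ E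
  obtain ⟨e, he⟩ := exists_isChartFrame (E := E) (Q.proj p)
  have transported_zero :
      (fun i => chartTangentFlow Z (Q.proj p) 0 (Y i (Q.proj p))) = fun i => Y i (Q.proj p) := by
    rw [chartTangentFlow_zero]
    rfl
  have restricted_zero : (fun i => chartField (Q.proj p) (Y i)
      (extChartAt 𝓘(ℝ, E) (Q.proj p) (flow Z 0 (Q.proj p)))) = fun i => Y i (Q.proj p) := by
    simp only [flow_zero]
    exact funext fun i => chartField_self
  have transported := A.hasDerivAt_frameMap_flow hρ Z β e p transported_zero fun i =>
    hasDerivAt_chartTangentFlow_apply Z (Q.proj p) (Y i (Q.proj p))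
  have restricted := A.hasDerivAt_frameMap_flow hρ Z β e p restricted_zero fun i =>
    hasDerivAt_chartField_flow Z (Y i) (Q.proj p)
  have nabla_eq := ((A.hasDerivAt_sectionFun_flow hρ Z (β.smooth Y) p).congr_of_eventuallyEq
    (A.eventually_sectionFun_flow_eq_frameMap he Z β Y).symm).unique restricted
  refine (transported.congr_of_eventuallyEq
    (A.eventually_darbouxLieCurve_eq_frameMap he Z β _)).congr_deriv ?_
  refine Eq.trans ?_ (A.coord_leibnizLie Z β Y (Q.self p)).symm
  rw [nabla_eq, Finset.sum_congr rfl fun i _ => β.coord_update_mlieBracket he Z (Y i) _ i,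
    Finset.sum_sub_distrib]
  abel

end PrincipalConnection

end MainComputation

/-! ### The Cartan formula -/

section Algebra

theorem succ_removeNth_vecCons {α : Type*} {m : ℕ} (j : Fin (m + 1)) (a : α)
    (v : Fin (m + 1) → α) :
    j.succ.removeNth (Matrix.vecCons a v) = Matrix.vecCons a (j.removeNth v) := by
  funext i
  cases i using Fin.cases <;> simp [Fin.removeNth]

theorem vecCons_apply_apply {ι : Type*} {T : ι → Type*} {m : ℕ} (Z : ∀ x, T x)
    (Y : Fin m → ∀ x, T x) (x : ι) :
    (fun i => Matrix.vecCons Z Y i x) = Matrix.vecCons (Z x) (fun i => Y i x) :=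
  Fin.comp_cons (fun X : ∀ x, T x => X x) Z Y

variable {R T N : Type*} [CommRing R] [AddCommGroup T] [Module R T] [AddCommGroup N] [Module R N]
  {m : ℕ}

theorem neg_one_pow_smul_map_vecCons_removeNth (f : T [⋀^Fin (m + 1)]→ₗ[R] N) (j : Fin (m + 1))
    (a : T) (v : Fin (m + 1) → T) :
    (-1 : R) ^ (j : ℕ) • f (Matrix.vecCons a (j.removeNth v)) = f (Function.update v j a) := by
  rw [← Fin.insertNth_removeNth, AlternatingMap.map_insertNth, ← Int.cast_smul_eq_zsmul R]
  simp only [Int.reduceNeg, Int.cast_pow, Int.cast_neg, Int.cast_one]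

theorem map_vecCons_vecCons_swap (f : T [⋀^Fin (m + 2)]→ₗ[R] N) (a b : T) (v : Fin m → T) :
    f (Matrix.vecCons a (Matrix.vecCons b v)) = -f (Matrix.vecCons b (Matrix.vecCons a v)) := by
  rw [← f.map_swap _ Fin.zero_ne_one, Matrix.cons_cons_comp_swap_zero_one]

end Algebra

section CartanFormula

variable
  {F : Type*} [NormedAddCommGroup F] [NormedSpace ℝ F]
  {G : Type*} [TopologicalSpace G] [ChartedSpace F G] [Group G] [LieGroup 𝓘(ℝ, F) ∞ G]
  {E : Type*} [NormedAddCommGroup E] [NormedSpace ℝ E]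
  {M : Type*} [TopologicalSpace M] [ChartedSpace E M] [IsManifold 𝓘(ℝ, E) ∞ M]
  {B : Type*} [NormedAddCommGroup B] [NormedSpace ℝ B]
  {P : Type*} [TopologicalSpace P] [ChartedSpace B P] [IsManifold 𝓘(ℝ, B) ∞ P]
  {V : Type*} [NormedAddCommGroup V] [NormedSpace ℝ V]
  {Q : PrincipalBundle F G E M B P} {ρ : Representation ℝ G V} {k : ℕ}

theorem AssocForm.interior_apply (Z : SmoothVF E M) (β : AssocForm Q ρ (k + 1)) (x : M)
    (v : Fin k → TangentSpace 𝓘(ℝ, E) x) :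
    (β.interior Z).toFun x v = β.toFun x (Matrix.vecCons (Z x) v) := rfl

/-- The part of the exterior covariant derivative that involves Lie brackets, with the sign
`(-1)^(i + j)` and the indexing of `PrincipalConnection.dNabla`; it is subtracted there. -/
def AssocForm.bracketSum : {k : ℕ} → AssocForm Q ρ k →
    (Fin (k + 1) → ∀ x : M, TangentSpace 𝓘(ℝ, E) x) → ∀ x : M, Assoc Q ρ x
  | 0, _, _, _ => 0
  | m + 1, β, X, x => ∑ i : Fin (m + 1), ∑ j ∈ Finset.Ici i, (-1 : ℝ) ^ ((i : ℕ) + (j : ℕ)) •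
      β.toFun x (Matrix.vecCons
        (VectorField.mlieBracket 𝓘(ℝ, E) (X (Fin.castSucc i)) (X (Fin.succ j)) x)
        (fun l => j.removeNth ((Fin.castSucc i).removeNth X) l x))

theorem AssocForm.bracketSum_succ (β : AssocForm Q ρ (k + 1))
    (X : Fin (k + 2) → ∀ x : M, TangentSpace 𝓘(ℝ, E) x) (x : M) :
    β.bracketSum X x =
      ∑ i : Fin (k + 1), ∑ j ∈ Finset.Ici i, (-1 : ℝ) ^ ((i : ℕ) + (j : ℕ)) •
        β.toFun x (Matrix.vecCons
          (VectorField.mlieBracket 𝓘(ℝ, E) (X (Fin.castSucc i)) (X (Fin.succ j)) x)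
          (fun l => j.removeNth ((Fin.castSucc i).removeNth X) l x)) := rfl

theorem AssocForm.sum_bracket_vecCons (β : AssocForm Q ρ (k + 1)) (Z : SmoothVF E M)
    (Y : Fin (k + 1) → ∀ x : M, TangentSpace 𝓘(ℝ, E) x) (x : M) :
    ∑ j ∈ Finset.Ici (0 : Fin (k + 1)), (-1 : ℝ) ^ (j : ℕ) • β.toFun x (Matrix.vecCons
        (VectorField.mlieBracket 𝓘(ℝ, E) Z (Y j) x) (fun l => j.removeNth Y l x)) =
      ∑ j, β.toFun x (Function.update (fun i => Y i x) j
        (VectorField.mlieBracket 𝓘(ℝ, E) Z (Y j) x)) := by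
  rw [← bot_eq_zero, Finset.Ici_bot]
  exact Finset.sum_congr rfl fun j _ =>
    neg_one_pow_smul_map_vecCons_removeNth (β.toFun x) j _ fun i => Y i x

theorem AssocForm.bracketSum_interior (Z : SmoothVF E M) (β : AssocForm Q ρ (k + 2))
    (Y : Fin (k + 2) → ∀ x : M, TangentSpace 𝓘(ℝ, E) x) (x : M) :
    (β.interior Z).bracketSum Y x =
      -∑ i : Fin (k + 1), ∑ j ∈ Finset.Ici i, (-1 : ℝ) ^ ((i : ℕ) + (j : ℕ)) •
        β.toFun x (Matrix.vecCons
          (VectorField.mlieBracket 𝓘(ℝ, E) (Y (Fin.castSucc i)) (Y (Fin.succ j)) x)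
          (Matrix.vecCons (Z x) fun l => j.removeNth ((Fin.castSucc i).removeNth Y) l x)) := by
  rw [bracketSum_succ]
  simp only [← Finset.sum_neg_distrib, ← smul_neg, interior_apply]
  simp only [map_vecCons_vecCons_swap (β.toFun x) (Z x)]

theorem AssocForm.bracketSum_vecCons (Z : SmoothVF E M) (β : AssocForm Q ρ (k + 1))
    (Y : Fin (k + 1) → ∀ x : M, TangentSpace 𝓘(ℝ, E) x) (x : M) :
    β.bracketSum (Matrix.vecCons Z Y) x =
      ∑ j, β.toFun x (Function.update (fun i => Y i x) j
        (VectorField.mlieBracket 𝓘(ℝ, E) Z (Y j) x)) - (β.interior Z).bracketSum Y x := by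
  rw [bracketSum_succ, Fin.sum_univ_succ, sub_eq_add_neg]
  congr 1
  · simp only [Fin.val_zero, zero_add]
    exact β.sum_bracket_vecCons Z Y x
  rcases k with _ | m
  · simp only [bracketSum, neg_zero, Finset.univ_eq_empty, Finset.sum_empty]
  rw [bracketSum_interior, neg_neg]
  refine Finset.sum_congr rfl fun i _ => ?_
  rw [Fin.sum_Ici_succ]
  refine Finset.sum_congr rfl fun j _ => ?_
  have sign : (-1 : ℝ) ^ ((i.succ : ℕ) + (j.succ : ℕ)) = (-1) ^ ((i : ℕ) + (j : ℕ)) := by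
    rw [Fin.val_succ, Fin.val_succ, add_add_add_comm, pow_add, one_add_one_eq_two, neg_one_sq,
      mul_one]
  rw [sign, Fin.castSucc_succ, succ_removeNth_vecCons, succ_removeNth_vecCons,
    vecCons_apply_apply]
  rfl

namespace PrincipalConnection

variable (A : PrincipalConnection Q)

theorem dNabla_eq_dNablaFirst_sub_bracketSum (β : AssocForm Q ρ k)
    (X : Fin (k + 1) → ∀ x : M, TangentSpace 𝓘(ℝ, E) x) (x : M) :
    A.dNabla β X x = A.dNablaFirst β X x - β.bracketSum X x := by
  cases k
  · exact (sub_zero _).symm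
  · rfl

theorem dNablaFirst_vecCons_of_zero (β : AssocForm Q ρ 0) (Z : SmoothVF E M)
    (Y : Fin 0 → ∀ x : M, TangentSpace 𝓘(ℝ, E) x) (x : M) :
    A.dNablaFirst β (Matrix.vecCons Z Y) x =
      A.nabla Z (fun y => β.toFun y (fun i => Y i y)) x := by
  rw [dNablaFirst, Fin.sum_univ_one, Fin.val_zero, pow_zero, one_smul]
  rfl

theorem dNablaFirst_vecCons (Z : SmoothVF E M) (β : AssocForm Q ρ (k + 1))
    (Y : Fin (k + 1) → ∀ x : M, TangentSpace 𝓘(ℝ, E) x) (x : M) :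
    A.dNablaFirst β (Matrix.vecCons Z Y) x =
      A.nabla Z (fun y => β.toFun y (fun i => Y i y)) x - A.dNablaFirst (β.interior Z) Y x := by
  rw [dNablaFirst, Fin.sum_univ_succ, dNablaFirst, sub_eq_add_neg, ← Finset.sum_neg_distrib]
  congr 1
  · rw [Fin.val_zero, pow_zero, one_smul]
    rfl
  · refine Finset.sum_congr rfl fun j _ => ?_
    rw [Fin.val_succ, pow_succ, mul_neg_one, neg_smul]
    congr 3
    funext y
    rw [succ_removeNth_vecCons, vecCons_apply_apply, AssocForm.interior_apply]

theorem covLie_eq_leibnizLie (Z : SmoothVF E M) (β : AssocForm Q ρ k)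
    (Y : Fin k → SmoothVF E M) (x : M) :
    A.covLie Z β (fun i => Y i) x = A.leibnizLie Z β Y x := by
  rcases k with _ | m
  · rw [leibnizLie, Finset.univ_eq_empty, Finset.sum_empty, sub_zero]
    exact A.dNablaFirst_vecCons_of_zero β Z _ x
  · rw [covLie, dNabla_eq_dNablaFirst_sub_bracketSum, dNabla_eq_dNablaFirst_sub_bracketSum,
      dNablaFirst_vecCons, AssocForm.bracketSum_vecCons, leibnizLie]
    abel

end PrincipalConnection

end CartanFormula

/-! ### The Darboux–Lie derivative as a form -/

section DarbouxLieForm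

variable
  {F : Type*} [NormedAddCommGroup F] [NormedSpace ℝ F]
  {G : Type*} [TopologicalSpace G] [ChartedSpace F G] [Group G] [LieGroup 𝓘(ℝ, F) ∞ G]
  {E : Type*} [NormedAddCommGroup E] [NormedSpace ℝ E]
  {M : Type*} [TopologicalSpace M] [ChartedSpace E M] [IsManifold 𝓘(ℝ, E) ∞ M]
  {B : Type*} [NormedAddCommGroup B] [NormedSpace ℝ B]
  {P : Type*} [TopologicalSpace P] [ChartedSpace B P] [IsManifold 𝓘(ℝ, B) ∞ P]
  {V : Type*} [NormedAddCommGroup V] [NormedSpace ℝ V]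
  {Q : PrincipalBundle F G E M B P} {ρ : Representation ℝ G V} {k : ℕ}

namespace PrincipalConnection

variable (A : PrincipalConnection Q) (hρ : ∀ g, Continuous (ρ g)) (Z : SmoothVF E M)
  (β : AssocForm Q ρ k) {x : M}

theorem darbouxLieCurve_horizontalLift_add (p : P) (w₁ w₂ : ⋀[ℝ]^k (TangentSpace 𝓘(ℝ, E) x)) :
    darbouxLieCurve (A.horizontalLift Z) (fun y => β.bundleMap y) p ⟨x, w₁ + w₂⟩ =
      darbouxLieCurve (A.horizontalLift Z) (fun y => β.bundleMap y) p ⟨x, w₁⟩ +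
        darbouxLieCurve (A.horizontalLift Z) (fun y => β.bundleMap y) p ⟨x, w₂⟩ := by
  funext t
  simp only [Pi.add_apply, darbouxLieCurve_horizontalLift, map_add]

theorem darbouxLieCurve_horizontalLift_smul (p : P) (c : ℝ)
    (w : ⋀[ℝ]^k (TangentSpace 𝓘(ℝ, E) x)) :
    darbouxLieCurve (A.horizontalLift Z) (fun y => β.bundleMap y) p ⟨x, c • w⟩ =
      c • darbouxLieCurve (A.horizontalLift Z) (fun y => β.bundleMap y) p ⟨x, w⟩ := by
  funext t
  simp only [Pi.smul_apply, darbouxLieCurve_horizontalLift, map_smul]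

variable {Z β} in
theorem darbouxLie_horizontalLift_eq {w : ⋀[ℝ]^k (TangentSpace 𝓘(ℝ, E) x)} {z : Assoc Q ρ x}
    (h : HasDerivAt (darbouxLieCurve (A.horizontalLift Z) (fun y => β.bundleMap y) (Q.point x).1
      ⟨x, w⟩) (Assoc.coord (Q.point x) z) 0) :
    darbouxLie (A.horizontalLift Z) (fun y => β.bundleMap y) x w = z := by
  rw [darbouxLie, h.deriv, Assoc.mk_coord]

variable [FiniteDimensional ℝ E] [CompleteSpace B] [T2Space M] [T2Space P]
include hρ

theorem exists_hasDerivAt_darbouxLieCurve (w : ⋀[ℝ]^k (TangentSpace 𝓘(ℝ, E) x)) :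
    ∃ z : Assoc Q ρ x, ∀ p : Q.Fiber x,
      HasDerivAt (darbouxLieCurve (A.horizontalLift Z) (fun y => β.bundleMap y) p.1 ⟨x, w⟩)
        (Assoc.coord p z) 0 := by
  have hw : w ∈ Submodule.span ℝ (Set.range (exteriorPower.ιMulti ℝ k
      (M := TangentSpace 𝓘(ℝ, E) x))) := by
    rw [exteriorPower.ιMulti_span]
    exact Submodule.mem_top
  induction hw using Submodule.span_induction with
  | mem w hw =>
    obtain ⟨v, rfl⟩ := hw
    choose Y hY using fun i => SmoothVF.exists_apply_eq x (v i)
    obtain rfl : (fun i => Y i x) = v := funext hY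
    exact ⟨A.leibnizLie Z β Y x, fun p => A.hasDerivAt_darbouxLieCurve_ιMulti hρ Z β Y p⟩
  | zero =>
    refine ⟨0, fun p => ?_⟩
    rw [← zero_smul ℝ 0, darbouxLieCurve_horizontalLift_smul, zero_smul]
    exact (hasDerivAt_const 0 0).congr_deriv (map_zero (Assoc.coordLinear p)).symm
  | add w₁ w₂ _ _ h₁ h₂ =>
    obtain ⟨z₁, h₁⟩ := h₁
    obtain ⟨z₂, h₂⟩ := h₂
    refine ⟨z₁ + z₂, fun p => ?_⟩
    rw [darbouxLieCurve_horizontalLift_add, Assoc.coord_add]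
    exact (h₁ p).add (h₂ p)
  | smul c w _ h =>
    obtain ⟨z, h⟩ := h
    refine ⟨c • z, fun p => ?_⟩
    rw [darbouxLieCurve_horizontalLift_smul, Assoc.coord_smul]
    exact (h p).const_smul c

theorem hasDerivAt_darbouxLieCurve (p : Q.Fiber x) (w : ⋀[ℝ]^k (TangentSpace 𝓘(ℝ, E) x)) :
    HasDerivAt (darbouxLieCurve (A.horizontalLift Z) (fun y => β.bundleMap y) p.1 ⟨x, w⟩)
      (Assoc.coord p (darbouxLie (A.horizontalLift Z) (fun y => β.bundleMap y) x w)) 0 := by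
  obtain ⟨z, hz⟩ := A.exists_hasDerivAt_darbouxLieCurve hρ Z β w
  rw [A.darbouxLie_horizontalLift_eq (hz _)]
  exact hz p

theorem darbouxLie_ιMulti (Y : Fin k → SmoothVF E M) (x : M) :
    darbouxLie (A.horizontalLift Z) (fun y => β.bundleMap y) x
      (exteriorPower.ιMulti ℝ k (fun i => Y i x)) = A.leibnizLie Z β Y x :=
  A.darbouxLie_horizontalLift_eq (A.hasDerivAt_darbouxLieCurve_ιMulti hρ Z β Y (Q.point x))

/-- The Darboux–Lie derivative of a `k`-form along a horizontal lift, as a bundle map. -/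
def darbouxLieLinear (x : M) : ⋀[ℝ]^k (TangentSpace 𝓘(ℝ, E) x) →ₗ[ℝ] Assoc Q ρ x where
  toFun := darbouxLie (A.horizontalLift Z) (fun y => β.bundleMap y) x
  map_add' w₁ w₂ := by
    refine A.darbouxLie_horizontalLift_eq ?_
    rw [darbouxLieCurve_horizontalLift_add, Assoc.coord_add]
    exact (A.hasDerivAt_darbouxLieCurve hρ Z β _ w₁).add (A.hasDerivAt_darbouxLieCurve hρ Z β _ w₂)
  map_smul' c w := by
    refine A.darbouxLie_horizontalLift_eq ?_
    rw [darbouxLieCurve_horizontalLift_smul, Assoc.coord_smul]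
    exact (A.hasDerivAt_darbouxLieCurve hρ Z β _ w).const_smul c

/-- The Darboux–Lie derivative of a `k`-form along a horizontal lift, as a `k`-form. -/
def darbouxLieForm : AssocForm Q ρ k where
  toFun x := exteriorPower.alternatingMapLinearEquiv.symm (A.darbouxLieLinear hρ Z β x)
  smooth Y := by
    have := FiniteDimensional.complete ℝ E
    convert! A.isSmoothSection_leibnizLie hρ Z β Y using 2 with x
    rw [exteriorPower.alternatingMapLinearEquiv_symm_apply]
    exact A.darbouxLie_ιMulti hρ Z β Y x

theorem bundleMap_darbouxLieForm (w : ⋀[ℝ]^k (TangentSpace 𝓘(ℝ, E) x)) :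
    (A.darbouxLieForm hρ Z β).bundleMap x w =
      darbouxLie (A.horizontalLift Z) (fun y => β.bundleMap y) x w := by
  rw [AssocForm.bundleMap, darbouxLieForm, LinearEquiv.apply_symm_apply]
  rfl

theorem darbouxLieForm_apply (Y : Fin k → SmoothVF E M) (x : M) :
    (A.darbouxLieForm hρ Z β).toFun x (fun i => Y i x) = A.leibnizLie Z β Y x := by
  rw [← AssocForm.bundleMap_ιMulti, bundleMap_darbouxLieForm, darbouxLie_ιMulti A hρ Z β]

end PrincipalConnection

end DarbouxLieForm

end DarbouxLie

end

open DarbouxLie in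
theorem mainTheorem12_general
    {F : Type*} [NormedAddCommGroup F] [NormedSpace ℝ F]
    {G : Type*} [TopologicalSpace G] [ChartedSpace F G] [Group G] [LieGroup 𝓘(ℝ, F) ∞ G]
    {E : Type*} [NormedAddCommGroup E] [NormedSpace ℝ E] [FiniteDimensional ℝ E]
    {M : Type*} [TopologicalSpace M] [T2Space M] [ChartedSpace E M] [IsManifold 𝓘(ℝ, E) ∞ M]
    {B : Type*} [NormedAddCommGroup B] [NormedSpace ℝ B] [CompleteSpace B]
    {P : Type*} [TopologicalSpace P] [T2Space P] [ChartedSpace B P] [IsManifold 𝓘(ℝ, B) ∞ P]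
    {V : Type*} [NormedAddCommGroup V] [NormedSpace ℝ V]
    (Q : PrincipalBundle F G E M B P) (A : PrincipalConnection Q)
    (ρ : Representation ℝ G V) (hρ : ∀ g, Continuous (ρ g))
    (Z : SmoothVF E M) (k : ℕ) (β : AssocForm Q ρ k) :
    (ContMDiff 𝓘(ℝ, B) 𝓘(ℝ, B).tangent ∞
        (fun p => (⟨p, A.horizontalLift Z p⟩ : TangentBundle 𝓘(ℝ, B) P)) ∧
      (∀ p g, A.horizontalLift Z (Q.act p g) =
        mfderiv 𝓘(ℝ, B) 𝓘(ℝ, B) (fun q => Q.act q g) p (A.horizontalLift Z p)) ∧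
      Q.base (A.horizontalLift Z) = Z) ∧
    (∀ (x : M) (p : Q.Fiber x) (w : ⋀[ℝ]^k (TangentSpace 𝓘(ℝ, E) x)),
      HasDerivAt (darbouxLieCurve (A.horizontalLift Z) (fun y => β.bundleMap y) p.1 ⟨x, w⟩)
        (Assoc.coord p (darbouxLie (A.horizontalLift Z) (fun y => β.bundleMap y) x w)) 0) ∧
    ∃ L : AssocForm Q ρ k,
      (∀ (x : M) (w : ⋀[ℝ]^k (TangentSpace 𝓘(ℝ, E) x)),
        darbouxLie (A.horizontalLift Z) (fun y => β.bundleMap y) x w = L.bundleMap x w) ∧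
      ∀ (Y : Fin k → SmoothVF E M) (x : M),
        L.toFun x (fun i => Y i x) = A.covLie Z β (fun i => Y i) x := by
  refine ⟨⟨A.smooth Z, A.equivariant Z, A.base_horizontalLift Z⟩,
    fun _ p w => A.hasDerivAt_darbouxLieCurve hρ Z β p w, A.darbouxLieForm hρ Z β,
    fun _ w => (A.bundleMap_darbouxLieForm hρ Z β w).symm, fun Y x => ?_⟩
  rw [A.covLie_eq_leibnizLie, A.darbouxLieForm_apply]

open DarbouxLie in
theorem mainTheorem12
    {F : Type*} [NormedAddCommGroup F] [NormedSpace ℝ F] [FiniteDimensional ℝ F]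
    {G : Type*} [TopologicalSpace G] [ChartedSpace F G] [Group G] [LieGroup 𝓘(ℝ, F) ∞ G]
    {E : Type*} [NormedAddCommGroup E] [NormedSpace ℝ E] [FiniteDimensional ℝ E]
    {M : Type*} [TopologicalSpace M] [T2Space M] [ChartedSpace E M] [IsManifold 𝓘(ℝ, E) ∞ M]
    {B : Type*} [NormedAddCommGroup B] [NormedSpace ℝ B] [FiniteDimensional ℝ B]
    {P : Type*} [TopologicalSpace P] [T2Space P] [ChartedSpace B P] [IsManifold 𝓘(ℝ, B) ∞ P]
    {V : Type*} [NormedAddCommGroup V] [NormedSpace ℝ V] [FiniteDimensional ℝ V]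
    (Q : PrincipalBundle F G E M B P) (A : PrincipalConnection Q)
    (ρ : Representation ℝ G V)
    (hρ : ContMDiff (𝓘(ℝ, F).prod 𝓘(ℝ, V)) 𝓘(ℝ, V) ∞ (fun a : G × V => ρ a.1 a.2))
    (Z : SmoothVF E M) (k : ℕ) (β : AssocForm Q ρ k) :
    -- `Z^H` is a smooth `G`-invariant vector field that projects onto `Z`
    (ContMDiff 𝓘(ℝ, B) 𝓘(ℝ, B).tangent ∞
        (fun p => (⟨p, A.horizontalLift Z p⟩ : TangentBundle 𝓘(ℝ, B) P)) ∧
      (∀ p g, A.horizontalLift Z (Q.act p g) =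
        mfderiv 𝓘(ℝ, B) 𝓘(ℝ, B) (fun q => Q.act q g) p (A.horizontalLift Z p)) ∧
      Q.base (A.horizontalLift Z) = Z) ∧
    -- the derivative that defines the Darboux–Lie derivative exists,
    -- and its value does not depend on the choice of a point in the fibre of `P`
    (∀ (x : M) (p : Q.Fiber x) (w : ⋀[ℝ]^k (TangentSpace 𝓘(ℝ, E) x)),
      HasDerivAt (darbouxLieCurve (A.horizontalLift Z) (fun y => β.bundleMap y) p.1 ⟨x, w⟩)
        (Assoc.coord p (darbouxLie (A.horizontalLift Z) (fun y => β.bundleMap y) x w)) 0) ∧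
    -- the Darboux–Lie derivative of `β` along `Z^H` is a `k`-form, namely `i_Z d^∇ β + d^∇ i_Z β`
    ∃ L : AssocForm Q ρ k,
      (∀ (x : M) (w : ⋀[ℝ]^k (TangentSpace 𝓘(ℝ, E) x)),
        darbouxLie (A.horizontalLift Z) (fun y => β.bundleMap y) x w = L.bundleMap x w) ∧
      ∀ (Y : Fin k → SmoothVF E M) (x : M),
        L.toFun x (fun i => Y i x) = A.covLie Z β (fun i => Y i) x := by
  have := FiniteDimensional.complete ℝ B
  exact mainTheorem12_general Q A ρ (fun g => hρ.continuous.comp (Continuous.prodMk_right g)) Z k β
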